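/- For an integer $n\ge 5$, let $\mathbb P_n\subset\mathbb R^2$ be the open regular polygon with $n$ sides inscribed in the unit circle, with vertices $(\cos\frac{2\pi k}{n},\sin\frac{2\pi k}{n})$, $0\le k\le n-1$. For an open set $\Omega\subset\mathbb R^2$, let $H^1(\Omega)$ be the Sobolev space of real functions $u\in L^2(\Omega)$ whose weak gradient $\nabla u$ belongs to $L^2(\Omega;\mathbb R^2)$, with the norm $\|u\|_{H^1(\Omega)}=\left(\int_\Omega u^2+\int_\Omega|\nabla u|^2\right)^{1/2}$. Set \[ C_5=4,\qquad C_n=\left[4+24\cos^2\frac{2\pi}{n}\right]^{1/2}\quad\text{for } n\ge 6. \] Then for every $n\ge 5$ there exists a bounded linear extension operator \[ \mathcal E: H^1(\mathbb P_n)\to H^1(\mathbb R^2), \] that is, a linear operator with $\mathcal E u=u$ almost everywhere on $\mathbb P_n$ for every $u\in H^1(\mathbb P_n)$, whose operator norm satisfies $\|\mathcal E\|\le C_n$. -/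

import Mathlib

open MeasureTheory
open scoped ContDiff RealInnerProductSpace

/-- The Euclidean plane. -/
abbrev Plane : Type := EuclideanSpace ℝ (Fin 2)

/-- The `k`-th vertex `(cos (2πk/n), sin (2πk/n))` of the regular `n`-gon inscribed in the
unit circle; the zeroth one is `(1, 0)`. -/
noncomputable def polygonVertex (n : ℕ) (k : Fin n) : Plane :=
  !₂[Real.cos (2 * Real.pi * (k : ℝ) / n), Real.sin (2 * Real.pi * (k : ℝ) / n)]

/-- The regular `n`-gon with circumradius one, as an open subset of the plane. -/
noncomputable def regularPolygon (n : ℕ) : Set Plane :=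
  interior (convexHull ℝ (Set.range (polygonVertex n)))

/-- `φ` belongs to `C_c^∞(Ω)`: it is smooth, with compact support contained in `Ω`. -/
def IsTestFunction (Ω : Set Plane) (φ : Plane → ℝ) : Prop :=
  ContDiff ℝ ∞ φ ∧ HasCompactSupport φ ∧ tsupport φ ⊆ Ω

/-- `g` is a weak gradient of `u` on `Ω`:
`∫_Ω u ∂_v φ = - ∫_Ω (g · v) φ` for all test functions `φ` and all directions `v`. -/
def IsWeakGradient (Ω : Set Plane) (u : Plane → ℝ) (g : Plane → Plane) : Prop :=
  ∀ φ : Plane → ℝ, IsTestFunction Ω φ → ∀ v : Plane,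
    ∫ x in Ω, u x * fderiv ℝ φ x v = - ∫ x in Ω, ⟪g x, v⟫ * φ x

theorem IsTestFunction.memLp {Ω : Set Plane} {φ : Plane → ℝ} (hφ : IsTestFunction Ω φ) :
    MemLp φ 2 (volume.restrict Ω) :=
  (hφ.1.continuous.memLp_of_hasCompactSupport hφ.2.1).restrict Ω

theorem IsTestFunction.memLp_fderiv {Ω : Set Plane} {φ : Plane → ℝ}
    (hφ : IsTestFunction Ω φ) (v : Plane) :
    MemLp (fun x => fderiv ℝ φ x v) 2 (volume.restrict Ω) := by
  have hc : Continuous (fun x => fderiv ℝ φ x v) :=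
    (hφ.1.continuous_fderiv (by simp)).clm_apply continuous_const
  exact (hc.memLp_of_hasCompactSupport (hφ.2.1.fderiv_apply (𝕜 := ℝ) v)).restrict Ω

theorem IsTestFunction.integrable_left {Ω : Set Plane} {φ : Plane → ℝ}
    (hφ : IsTestFunction Ω φ) (v : Plane) (u : Lp ℝ 2 (volume.restrict Ω)) :
    Integrable (fun x => u x * fderiv ℝ φ x v) (volume.restrict Ω) :=
  (Lp.memLp u).integrable_mul (hφ.memLp_fderiv v)

theorem IsTestFunction.integrable_right {Ω : Set Plane} {φ : Plane → ℝ}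
    (hφ : IsTestFunction Ω φ) (v : Plane) (g : Lp Plane 2 (volume.restrict Ω)) :
    Integrable (fun x => ⟪g x, v⟫ * φ x) (volume.restrict Ω) :=
  ((Lp.memLp g).inner_const v).integrable_mul hφ.memLp

/-- The real Sobolev space `H¹(Ω)` of an open set `Ω`, as the space of the pairs `(u, ∇u)` with
`u ∈ L²(Ω)` and weak gradient `∇u ∈ L²(Ω; ℝ²)`. The norm is inherited from the `ℓ²` product, so
`‖u‖_{H¹}² = ‖u‖_{L²}² + ‖∇u‖_{L²}²`. On an open set the second component is determined
by the first one. -/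
noncomputable def sobolevSubmodule (Ω : Set Plane) :
    Submodule ℝ (WithLp 2 (Lp ℝ 2 (volume.restrict Ω) × Lp Plane 2 (volume.restrict Ω))) where
  carrier := {w | IsWeakGradient Ω w.fst w.snd}
  zero_mem' := by
    intro φ _ v
    have h1 : (fun x => (0 : Lp ℝ 2 (volume.restrict Ω)) x * fderiv ℝ φ x v)
        =ᵐ[volume.restrict Ω] fun _ => 0 := by
      filter_upwards [Lp.coeFn_zero ℝ 2 (volume.restrict Ω)] with x hx
      rw [hx, Pi.zero_apply, zero_mul]
    have h2 : (fun x => ⟪(0 : Lp Plane 2 (volume.restrict Ω)) x, v⟫ * φ x)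
        =ᵐ[volume.restrict Ω] fun _ => 0 := by
      filter_upwards [Lp.coeFn_zero Plane 2 (volume.restrict Ω)] with x hx
      rw [hx, Pi.zero_apply, inner_zero_left, zero_mul]
    simp only [WithLp.zero_fst, WithLp.zero_snd]
    rw [integral_congr_ae h1, integral_congr_ae h2]
    simp
  add_mem' := by
    intro a b ha hb φ hφ v
    have h1 : (fun x => (a.fst + b.fst) x * fderiv ℝ φ x v) =ᵐ[volume.restrict Ω]
        fun x => a.fst x * fderiv ℝ φ x v + b.fst x * fderiv ℝ φ x v := by
      filter_upwards [Lp.coeFn_add a.fst b.fst] with x hx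
      rw [hx, Pi.add_apply, add_mul]
    have h2 : (fun x => ⟪(a.snd + b.snd) x, v⟫ * φ x) =ᵐ[volume.restrict Ω]
        fun x => ⟪a.snd x, v⟫ * φ x + ⟪b.snd x, v⟫ * φ x := by
      filter_upwards [Lp.coeFn_add a.snd b.snd] with x hx
      rw [hx, Pi.add_apply, inner_add_left, add_mul]
    simp only [WithLp.add_fst, WithLp.add_snd]
    rw [integral_congr_ae h1, integral_congr_ae h2,
      integral_add (hφ.integrable_left v _) (hφ.integrable_left v _),
      integral_add (hφ.integrable_right v _) (hφ.integrable_right v _), ha φ hφ v, hb φ hφ v]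
    ring
  smul_mem' := by
    intro c a ha φ hφ v
    have h1 : (fun x => (c • a.fst) x * fderiv ℝ φ x v) =ᵐ[volume.restrict Ω]
        fun x => c * (a.fst x * fderiv ℝ φ x v) := by
      filter_upwards [Lp.coeFn_smul c a.fst] with x hx
      rw [hx, Pi.smul_apply, smul_eq_mul, mul_assoc]
    have h2 : (fun x => ⟪(c • a.snd) x, v⟫ * φ x) =ᵐ[volume.restrict Ω]
        fun x => c * (⟪a.snd x, v⟫ * φ x) := by
      filter_upwards [Lp.coeFn_smul c a.snd] with x hx
      rw [hx, Pi.smul_apply, real_inner_smul_left, mul_assoc]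
    simp only [WithLp.smul_fst, WithLp.smul_snd]
    rw [integral_congr_ae h1, integral_congr_ae h2, integral_const_mul, integral_const_mul,
      ha φ hφ v]
    ring

/-- The Sobolev space `H¹(Ω)` as a normed space. -/
abbrev SobolevH1 (Ω : Set Plane) : Type := sobolevSubmodule Ω

/-- The function underlying an element of `H¹(Ω)`. -/
noncomputable def SobolevH1.toLp {Ω : Set Plane} (u : SobolevH1 Ω) :
    Lp ℝ 2 (volume.restrict Ω) :=
  u.1.fst

/-- The weak gradient of an element of `H¹(Ω)`. -/
noncomputable def SobolevH1.grad {Ω : Set Plane} (u : SobolevH1 Ω) :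
    Lp Plane 2 (volume.restrict Ω) :=
  u.1.snd

theorem SobolevH1.norm_sq {Ω : Set Plane} (u : SobolevH1 Ω) :
    ‖u‖ ^ 2 = (∫ x in Ω, (u.toLp x) ^ 2) + ∫ x in Ω, ‖u.grad x‖ ^ 2 := by
  have h : ‖u‖ ^ 2 = ‖u.toLp‖ ^ 2 + ‖u.grad‖ ^ 2 := WithLp.prod_norm_sq_eq_of_L2 u.1
  rw [h, ← real_inner_self_eq_norm_sq, ← real_inner_self_eq_norm_sq, L2.inner_def, L2.inner_def]
  simp

theorem SobolevH1.toLp_injective {Ω : Set Plane} (hΩ : IsOpen Ω) :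
    Function.Injective (SobolevH1.toLp : SobolevH1 Ω → Lp ℝ 2 (volume.restrict Ω)) := by
  intro a b hab
  have key : ∀ v : Plane, ∀ᵐ x ∂volume.restrict Ω, ⟪a.grad x - b.grad x, v⟫ = 0 := by
    intro v
    have hloc : LocallyIntegrableOn (fun x => ⟪a.grad x - b.grad x, v⟫) Ω volume := by
      have hm : MemLp (fun x => ⟪a.grad x - b.grad x, v⟫) 2 (volume.restrict Ω) :=
        ((Lp.memLp a.grad).sub (Lp.memLp b.grad)).inner_const v
      exact locallyIntegrableOn_of_locallyIntegrable_restrict (hm.locallyIntegrable (by norm_num))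
    have := hΩ.ae_eq_zero_of_integral_contDiff_smul_eq_zero hloc (by
      intro φ h1 h2 h3
      have hφ : IsTestFunction Ω φ := ⟨h1, h2, h3⟩
      have ea := a.2 φ hφ v
      have eb := b.2 φ hφ v
      have e : (∫ x in Ω, ⟪a.grad x, v⟫ * φ x) = ∫ x in Ω, ⟪b.grad x, v⟫ * φ x := by
        apply neg_injective
        refine ea.symm.trans (Eq.trans ?_ eb)
        change ∫ x in Ω, a.toLp x * _ = ∫ x in Ω, b.toLp x * _
        rw [hab]
      have e2 : ∫ x in Ω, φ x • ⟪a.grad x - b.grad x, v⟫ = 0 := by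
        have := integral_sub (hφ.integrable_right v a.grad) (hφ.integrable_right v b.grad)
        rw [e, sub_self] at this
        rw [← this]
        congr 1
        ext x
        rw [inner_sub_left, smul_eq_mul]
        ring
      rw [← e2]
      symm
      apply setIntegral_eq_integral_of_forall_compl_eq_zero
      intro x hx
      have : φ x = 0 := image_eq_zero_of_notMem_tsupport fun h => hx (h3 h)
      simp [this])
    exact (ae_restrict_iff' hΩ.measurableSet).2 this
  have hg : a.grad = b.grad := by
    apply Lp.ext
    have hk : ∀ i : Fin 2, ∀ᵐ x ∂volume.restrict Ω,
        ⟪a.grad x - b.grad x, EuclideanSpace.single i (1 : ℝ)⟫ = 0 := fun i => key _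
    filter_upwards [hk 0, hk 1] with x h0 h1
    rw [← sub_eq_zero]
    ext i
    fin_cases i
    · simpa [EuclideanSpace.inner_single_right] using h0
    · simpa [EuclideanSpace.inner_single_right] using h1
  apply Subtype.ext
  apply (WithLp.equiv 2 _).injective
  exact Prod.ext hab hg

/-- `E u` extends `u` for all `u`: the restriction of `E u` to `Ω` is `u`, almost everywhere. -/
def IsExtensionOperator {Ω : Set Plane}
    (E : SobolevH1 Ω →L[ℝ] SobolevH1 (Set.univ : Set Plane)) : Prop :=
  ∀ u : SobolevH1 Ω, ∀ᵐ x ∂(volume.restrict Ω), (E u).toLp x = u.toLp x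

/-- The bound `C_n`, used for `n ≥ 5` only. -/
noncomputable def extensionConstant (n : ℕ) : ℝ :=
  if n = 5 then 4 else Real.sqrt (4 + 24 * Real.cos (2 * Real.pi / n) ^ 2)

/-! ### Linear algebra of oblique reflections in the plane -/

/-! Only three properties of the polygon matter: it is open, convex, and lies between the discs of
radius `a` and `1`, where `a` is a lower bound for the inradius `cos (π/n)`. Let `R` be the gauge.
Outside `Ω`, the inversion `x ↦ R⁻² x` sends gauge `R` to `R⁻¹`, and a smooth `φ` is extended by
`R⁻² φ(R⁻² x)`. The weight is chosen so that its square `R⁻⁴` is the Jacobian of the inversion: the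
exterior `L²` mass becomes an integral over `Ω` by change of variables.

With `m = ∇R` and `y = x/R`, Euler's identity gives `⟪m, y⟫ = 1`, so the differential of the
inversion is `R⁻²` times the oblique reflection `v ↦ v - 2⟪m, v⟫ y`. Its Gram matrix has determinant
`1` and trace `4‖m‖²‖y‖² - 2 ≤ 4/a² - 2`, hence squared norm at most `L` as soon as `L ≥ 1` and `L +
1/L ≥ 4/a² - 2` (`norm_sq_sub_smul_le_of_inner_eq_one`). The gradient of the extension is this
reflected gradient plus a term from differentiating the weight. Young's inequality with coefficients
`3` and `3/2` bounds the exterior energy by `K` times the interior one, for `K ≥ 3L` and `K ≥ 6/a² +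
1` (`Convex.energy_density_foldExtension_le`). The operator norm is then at most `√(1 + K)`.

The extension of a smooth function is Lipschitz, so its a.e. gradient is its weak gradient and no
boundary term appears. Smooth functions are dense in `H¹(Ω)` by convexity
(`denseRange_smoothToSobolev`), and the operator extends by continuity. The constants follow from `a
= 4/5` for `n = 5` and `a = √3/2` for `n ≥ 6`. -/

theorem quadraticForm_nonneg_of_trace_det {p q r : ℝ} (htr : 0 ≤ p + r) (hdet : q ^ 2 ≤ p * r)
    (s t : ℝ) : 0 ≤ p * s ^ 2 + 2 * q * s * t + r * t ^ 2 := by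
  have hpr : 0 ≤ p * r := (sq_nonneg q).trans hdet
  have hp : 0 ≤ p := by
    by_contra! h
    have : 0 < r := by linarith
    nlinarith
  rcases hp.eq_or_lt with rfl | hp
  · have hq : q = 0 := by nlinarith [sq_nonneg q]
    subst hq
    have : 0 ≤ r := by linarith
    nlinarith [mul_nonneg this (sq_nonneg t)]
  · have h : 0 ≤ p * (p * s ^ 2 + 2 * q * s * t + r * t ^ 2) := by
      have e : p * (p * s ^ 2 + 2 * q * s * t + r * t ^ 2)
          = (p * s + q * t) ^ 2 + (p * r - q ^ 2) * t ^ 2 := by ring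
      rw [e]
      have := mul_nonneg (sub_nonneg.2 hdet) (sq_nonneg t)
      positivity
    exact nonneg_of_mul_nonneg_right h hp

/-- The adjoint of the oblique reflection `v ↦ v - 2 ⟪m, v⟫ y` has norm at most `√L`. -/
theorem norm_sq_sub_smul_le_of_inner_eq_one {L : ℝ} (hL : 1 ≤ L) {m y : Plane} (h : ⟪m, y⟫ = 1)
    (hT : (4 * (‖m‖ ^ 2 * ‖y‖ ^ 2) - 2) * L ≤ L ^ 2 + 1) (G : Plane) :
    ‖G - (2 * ⟪G, y⟫) • m‖ ^ 2 ≤ L * ‖G‖ ^ 2 := by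
  simp only [EuclideanSpace.real_norm_sq_eq, Fin.sum_univ_two, PiLp.inner_apply,
    PiLp.sub_apply, PiLp.smul_apply, smul_eq_mul, RCLike.inner_apply, conj_trivial] at *
  generalize m 0 = a at *
  generalize m 1 = b at *
  generalize y 0 = c at *
  generalize y 1 = d at *
  generalize G 0 = s at *
  generalize G 1 = t at *
  -- The form is `L‖G‖²` minus the squared norm of the image. Its trace is nonnegative since `L +
  -- 1/L ≤ 2L`, and its determinant is `L² - L·tr + 1`, because the Gram matrix has determinant `1`;
  -- `hT` makes this nonnegative.
  have hq := quadraticForm_nonneg_of_trace_det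
    (p := L - (1 - 4 * a * c + 4 * (a ^ 2 + b ^ 2) * c ^ 2))
    (q := -(-2 * a * d - 2 * b * c + 4 * (a ^ 2 + b ^ 2) * c * d))
    (r := L - (1 - 4 * b * d + 4 * (a ^ 2 + b ^ 2) * d ^ 2)) ?_ ?_ s t
  · linear_combination hq
  · have e : L - (1 - 4 * a * c + 4 * (a ^ 2 + b ^ 2) * c ^ 2)
        + (L - (1 - 4 * b * d + 4 * (a ^ 2 + b ^ 2) * d ^ 2))
        = 2 * L - (4 * ((a ^ 2 + b ^ 2) * (c ^ 2 + d ^ 2)) - 2) := by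
      linear_combination 4 * h
    rw [e]
    nlinarith
  · have e : (1 - 4 * a * c + 4 * (a ^ 2 + b ^ 2) * c ^ 2)
        * (1 - 4 * b * d + 4 * (a ^ 2 + b ^ 2) * d ^ 2)
        - (-2 * a * d - 2 * b * c + 4 * (a ^ 2 + b ^ 2) * c * d) ^ 2 = 1 := by
      have e1 : (1 - 4 * a * c + 4 * (a ^ 2 + b ^ 2) * c ^ 2)
        * (1 - 4 * b * d + 4 * (a ^ 2 + b ^ 2) * d ^ 2)
        - (-2 * a * d - 2 * b * c + 4 * (a ^ 2 + b ^ 2) * c * d) ^ 2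
        = (1 - 2 * (c * a + d * b)) ^ 2 := by ring
      have h' : c * a + d * b = 1 := by linarith
      rw [e1, h']; norm_num
    have e2 : (1 - 4 * a * c + 4 * (a ^ 2 + b ^ 2) * c ^ 2)
        + (1 - 4 * b * d + 4 * (a ^ 2 + b ^ 2) * d ^ 2)
        = (4 * ((a ^ 2 + b ^ 2) * (c ^ 2 + d ^ 2)) - 2) := by
      linear_combination -4 * h
    rw [← e2] at hT
    nlinarith

/-- The determinant of a multiple of an oblique reflection of the plane. -/
theorem det_smul_id_sub_smulRight (r : ℝ) (f : Plane →L[ℝ] ℝ) {y : Plane} (h : f y = 1) :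
    (r • (ContinuousLinearMap.id ℝ Plane - (2 : ℝ) • f.smulRight y)).det = -r ^ 2 := by
  have e : ((r • (ContinuousLinearMap.id ℝ Plane - (2 : ℝ) • f.smulRight y) : Plane →L[ℝ] Plane)
      : Plane →ₗ[ℝ] Plane) = r • LinearMap.transvection (f : Plane →ₗ[ℝ] ℝ) (-(2 : ℝ) • y) := by
    ext1 v
    simp only [ContinuousLinearMap.coe_coe, smul_apply,
      sub_apply, ContinuousLinearMap.id_apply,
      ContinuousLinearMap.smulRight_apply, LinearMap.smul_apply, LinearMap.transvection.apply]
    module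
  rw [ContinuousLinearMap.det, e, LinearMap.det_smul, LinearMap.transvection.det]
  simp [h]
  ring

/-! ### Elementary geometry of the regular polygon -/

/-- The vertex directions are spaced by `2π/n`, so some vertex makes an angle at most `π/n` with
`e`. -/
theorem exists_polygonVertex_inner_ge {n : ℕ} (hn : 0 < n) (e : Plane) :
    ∃ k : Fin n, Real.cos (Real.pi / n) * ‖e‖ ≤ ⟪e, polygonVertex n k⟫ := by
  have hn0 : (0 : ℝ) < n := by exact_mod_cast hn
  have hpi := Real.pi_pos
  set z : ℂ := ⟨e 0, e 1⟩ with hz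
  have hnorm : ‖z‖ = ‖e‖ := by
    rw [EuclideanSpace.norm_eq, Complex.norm_eq_sqrt_sq_add_sq]
    simp [hz]
  set t := z.arg with ht
  set j : ℤ := round (t * n / (2 * Real.pi)) with hj
  have hround := abs_sub_round (t * n / (2 * Real.pi))
  set k : ℕ := (j % n).toNat with hk
  have hnZ : (0 : ℤ) < n := by exact_mod_cast hn
  have hk0 : (k : ℤ) = j % n := Int.toNat_of_nonneg (Int.emod_nonneg _ hnZ.ne')
  have hkn : k < n := by
    have := Int.emod_lt_of_pos j hnZ
    omega
  refine ⟨⟨k, hkn⟩, ?_⟩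
  have hjk : (j : ℝ) = k + n * (j / n : ℤ) := by
    have : j = k + n * (j / n) := by rw [hk0]; exact (Int.emod_add_mul_ediv j n).symm
    exact_mod_cast this
  have hangle : Real.cos (t - 2 * Real.pi * k / n) = Real.cos (t - 2 * Real.pi * j / n) := by
    have : t - 2 * Real.pi * k / n
        = t - 2 * Real.pi * j / n + (j / n : ℤ) * (2 * Real.pi) := by
      rw [hjk]; field_simp; ring
    rw [this, Real.cos_add_int_mul_two_pi]
  have habs : |t - 2 * Real.pi * j / n| ≤ Real.pi / n := by
    have e : t - 2 * Real.pi * j / n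
        = (t * n / (2 * Real.pi) - j) * (2 * Real.pi / n) := by field_simp
    rw [e, abs_mul, abs_of_pos (by positivity : 0 < 2 * Real.pi / n)]
    calc _ ≤ 1 / 2 * (2 * Real.pi / n) := by gcongr
      _ = Real.pi / n := by ring
  have hcos : Real.cos (Real.pi / n) ≤ Real.cos (t - 2 * Real.pi * j / n) := by
    rw [← Real.cos_abs (t - 2 * Real.pi * j / n)]
    apply Real.cos_le_cos_of_nonneg_of_le_pi (abs_nonneg _) _ habs
    exact div_le_self hpi.le (by exact_mod_cast hn)
  have h0 : e 0 = ‖e‖ * Real.cos t := by rw [← hnorm, ht, Complex.norm_mul_cos_arg]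
  have h1 : e 1 = ‖e‖ * Real.sin t := by rw [← hnorm, ht, Complex.norm_mul_sin_arg]
  have hinner : ⟪e, polygonVertex n ⟨k, hkn⟩⟫
      = ‖e‖ * Real.cos (t - 2 * Real.pi * k / n) := by
    rw [Real.cos_sub]
    simp only [polygonVertex, PiLp.inner_apply, Fin.sum_univ_two, RCLike.inner_apply,
      conj_trivial, h0, h1]
    simp
    ring
  rw [hinner, hangle, mul_comm]
  gcongr

theorem isOpen_regularPolygon (n : ℕ) : IsOpen (regularPolygon n) := isOpen_interior

theorem convex_regularPolygon (n : ℕ) : Convex ℝ (regularPolygon n) :=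
  (convex_convexHull ℝ _).interior

theorem regularPolygon_subset_closedBall (n : ℕ) :
    regularPolygon n ⊆ Metric.closedBall 0 1 := by
  refine interior_subset.trans (convexHull_min ?_ (convex_closedBall 0 1))
  rintro _ ⟨k, rfl⟩
  rw [mem_closedBall_zero_iff, EuclideanSpace.norm_eq]
  simp [polygonVertex]

/-- A point outside the hull is strictly separated from it by a linear functional, but some vertex
reaches at least `cos (π/n)` in every unit direction. -/
theorem ball_subset_regularPolygon {n : ℕ} (hn : 0 < n) :
    Metric.ball 0 (Real.cos (Real.pi / n)) ⊆ regularPolygon n := by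
  refine interior_maximal ?_ Metric.isOpen_ball
  intro x hx
  by_contra hxn
  have hclosed : IsClosed (convexHull ℝ (Set.range (polygonVertex n))) :=
    ((Set.finite_range _).isCompact_convexHull (𝕜 := ℝ)).isClosed
  obtain ⟨f, u, hfx, hfu⟩ := geometric_hahn_banach_point_closed (convex_convexHull ℝ _) hclosed hxn
  set e : Plane := (InnerProductSpace.toDual ℝ Plane).symm f with he
  have hef : ∀ v, f v = ⟪e, v⟫ := fun v => by rw [he, InnerProductSpace.toDual_symm_apply]
  -- The functional is smaller at `x` than on the hull, so the vertex is sought in the direction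
  -- `-e`.
  obtain ⟨k, hk⟩ := exists_polygonVertex_inner_ge hn (-e)
  have h1 := hfu _ (subset_convexHull ℝ _ ⟨k, rfl⟩)
  rw [hef] at h1 hfx
  rw [norm_neg, inner_neg_left] at hk
  rw [mem_ball_zero_iff] at hx
  have h2 := abs_le.1 (abs_real_inner_le_norm e x)
  have h3 : ‖e‖ * ‖x‖ ≤ ‖e‖ * Real.cos (Real.pi / n) := by gcongr
  linarith [h2.1]

/-! ### Lipschitz functions as elements of the Sobolev space -/

/-- Rademacher's theorem and integration by parts for Lipschitz functions. This is what glues the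
inside and the outside of `Ω`. -/
theorem LipschitzWith.isWeakGradient {Ω : Set Plane} {w : Plane → ℝ} {C : NNReal}
    (hw : LipschitzWith C w) : IsWeakGradient Ω w (gradient w) := by
  intro φ hφ v
  have hsupp : ∀ x ∉ Ω, φ x = 0 := fun x hx =>
    image_eq_zero_of_notMem_tsupport fun h => hx (hφ.2.2 h)
  have hsupp' : ∀ x ∉ Ω, fderiv ℝ φ x = 0 := fun x hx =>
    image_eq_zero_of_notMem_tsupport fun h => hx (hφ.2.2 (tsupport_fderiv_subset ℝ h))
  rw [setIntegral_eq_integral_of_forall_compl_eq_zero (fun x hx => by simp [hsupp' x hx]),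
    setIntegral_eq_integral_of_forall_compl_eq_zero (fun x hx => by simp [hsupp x hx])]
  obtain ⟨D, hD⟩ := hφ.1.lipschitzWith_of_hasCompactSupport hφ.2.1 (by simp)
  have key := hw.integral_lineDeriv_mul_eq (μ := volume) hD hφ.2.1 v
  have e1 : ∫ x, ⟪gradient w x, v⟫ * φ x = ∫ x, lineDeriv ℝ w x v * φ x := by
    apply integral_congr_ae
    filter_upwards [hw.ae_differentiableAt (μ := volume)] with x hx
    rw [inner_gradient_left, hx.lineDeriv_eq_fderiv]
  have e2 : ∫ x, w x * fderiv ℝ φ x v = - ∫ x, lineDeriv ℝ φ x (-v) * w x := by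
    rw [← integral_neg]
    congr 1
    ext x
    rw [(hφ.1.differentiable (by simp) x).lineDeriv_eq_fderiv, map_neg]
    ring
  rw [e1, e2, key]

theorem aestronglyMeasurable_gradient (w : Plane → ℝ) (μ : Measure Plane) :
    AEStronglyMeasurable (gradient w) μ := by
  have : Measurable (gradient w) :=
    ((InnerProductSpace.toDual ℝ Plane).symm.continuous.measurable).comp (measurable_fderiv ℝ w)
  exact this.aestronglyMeasurable

theorem LipschitzWith.gradient_add_ae {a b : Plane → ℝ} {C D : NNReal} (hC : LipschitzWith C a)
    (hD : LipschitzWith D b) : gradient (a + b) =ᵐ[volume] gradient a + gradient b := by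
  filter_upwards [hC.ae_differentiableAt (μ := volume),
    hD.ae_differentiableAt (μ := volume)] with x h1 h2
  simp only [Pi.add_apply, gradient]
  rw [fderiv_add h1 h2, map_add]

theorem gradient_const_smul_eq (c : ℝ) (a : Plane → ℝ) : gradient (c • a) = c • gradient a := by
  ext1 x
  simp only [Pi.smul_apply, gradient]
  rw [fderiv_const_smul_field, Pi.smul_apply, ← map_smul]

/-- The Lipschitz functions on the plane which are square integrable on `Ω` with their
gradients. -/
def lipschitzSobolev (Ω : Set Plane) : Submodule ℝ (Plane → ℝ) where
  carrier := {w | (∃ C, LipschitzWith C w) ∧ MemLp w 2 (volume.restrict Ω) ∧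
    MemLp (gradient w) 2 (volume.restrict Ω)}
  zero_mem' := by
    refine ⟨⟨0, LipschitzWith.const 0⟩, MemLp.zero, ?_⟩
    have : gradient (0 : Plane → ℝ) = fun _ => 0 := gradient_const' 0
    rw [this]
    exact MemLp.zero
  add_mem' := by
    rintro a b ⟨⟨C, hC⟩, ha, ha'⟩ ⟨⟨D, hD⟩, hb, hb'⟩
    exact ⟨⟨C + D, hC.add hD⟩, ha.add hb,
      (memLp_congr_ae (ae_restrict_of_ae (hC.gradient_add_ae hD))).2 (ha'.add hb')⟩
  smul_mem' := by
    rintro c a ⟨⟨C, hC⟩, ha, ha'⟩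
    refine ⟨⟨_, (lipschitzWith_smul c).comp hC⟩, ha.const_smul c, ?_⟩
    rw [gradient_const_smul_eq]
    exact ha'.const_smul c

/-- The embedding of Lipschitz functions into the Sobolev space. -/
noncomputable def lipschitzToSobolev (Ω : Set Plane) : lipschitzSobolev Ω →ₗ[ℝ] SobolevH1 Ω where
  toFun w := ⟨WithLp.toLp 2 (w.2.2.1.toLp, w.2.2.2.toLp), by
    intro φ hφ v
    obtain ⟨C, hC⟩ := w.2.1
    refine Eq.trans ?_ ((hC.isWeakGradient φ hφ v).trans ?_)
    · apply integral_congr_ae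
      filter_upwards [w.2.2.1.coeFn_toLp] with x hx
      exact congrArg (· * _) hx
    · congr 1
      apply integral_congr_ae
      filter_upwards [w.2.2.2.coeFn_toLp] with x hx
      exact congrArg (fun z => ⟪z, v⟫ * φ x) hx.symm⟩
  map_add' a b := by
    obtain ⟨C, hC⟩ := a.2.1
    obtain ⟨D, hD⟩ := b.2.1
    apply Subtype.ext
    apply (WithLp.equiv 2 _).injective
    refine Prod.ext rfl ?_
    exact (MemLp.toLp_congr (a + b).2.2.2 (a.2.2.2.add b.2.2.2)
      (ae_restrict_of_ae (hC.gradient_add_ae hD))).trans (MemLp.toLp_add a.2.2.2 b.2.2.2)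
  map_smul' c a := by
    apply Subtype.ext
    apply (WithLp.equiv 2 _).injective
    refine Prod.ext rfl ?_
    exact (MemLp.toLp_congr (c • a).2.2.2 (a.2.2.2.const_smul c)
      (Filter.EventuallyEq.of_eq (gradient_const_smul_eq c a.1))).trans
      (MemLp.toLp_const_smul c a.2.2.2)

theorem lipschitzToSobolev_toLp {Ω : Set Plane} (w : lipschitzSobolev Ω) :
    (lipschitzToSobolev Ω w).toLp = w.2.2.1.toLp := rfl

theorem lipschitzToSobolev_grad {Ω : Set Plane} (w : lipschitzSobolev Ω) :
    (lipschitzToSobolev Ω w).grad = w.2.2.2.toLp := rfl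

theorem MeasureTheory.lintegral_enorm_sq_eq_eLpNorm_sq {α F : Type*} [MeasurableSpace α]
    [NormedAddCommGroup F] (μ : Measure α) (f : α → F) :
    ∫⁻ x, ‖f x‖ₑ ^ 2 ∂μ = eLpNorm f 2 μ ^ 2 := by
  have := eLpNorm_nnreal_pow_eq_lintegral (f := f) (p := 2) (μ := μ) (by norm_num)
  simpa using this.symm

/-- Lower integrals allow the energies to be compared by change of variables before integrability is
known. -/
theorem ofReal_norm_sq_lipschitzToSobolev {Ω : Set Plane} (w : lipschitzSobolev Ω) :
    ENNReal.ofReal (‖lipschitzToSobolev Ω w‖ ^ 2)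
      = ∫⁻ x in Ω, (‖w.1 x‖ₑ ^ 2 + ‖gradient w.1 x‖ₑ ^ 2) := by
  have h : ‖lipschitzToSobolev Ω w‖ ^ 2
      = ‖(lipschitzToSobolev Ω w).toLp‖ ^ 2 + ‖(lipschitzToSobolev Ω w).grad‖ ^ 2 :=
    WithLp.prod_norm_sq_eq_of_L2 (lipschitzToSobolev Ω w).1
  rw [h, lipschitzToSobolev_toLp, lipschitzToSobolev_grad, Lp.norm_toLp, Lp.norm_toLp,
    ENNReal.ofReal_add (by positivity) (by positivity), ENNReal.ofReal_pow (by positivity),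
    ENNReal.ofReal_pow (by positivity), ENNReal.ofReal_toReal w.2.2.1.eLpNorm_ne_top,
    ENNReal.ofReal_toReal w.2.2.2.eLpNorm_ne_top,
    lintegral_add_left' (w.2.2.1.1.enorm.pow_const 2),
    lintegral_enorm_sq_eq_eLpNorm_sq, lintegral_enorm_sq_eq_eLpNorm_sq]

/-! ### Smooth functions with compact support -/

/-- The space of smooth functions with compact support in the plane. -/
def smoothCompactSupport : Submodule ℝ (Plane → ℝ) where
  carrier := {φ | ContDiff ℝ ∞ φ ∧ HasCompactSupport φ}
  zero_mem' := ⟨contDiff_const, HasCompactSupport.zero⟩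
  add_mem' ha hb := ⟨ha.1.add hb.1, ha.2.add hb.2⟩
  smul_mem' c _ ha := ⟨ha.1.const_smul c, ha.2.smul_left (f := fun _ => c)⟩

theorem continuous_gradient_of_contDiff {φ : Plane → ℝ} (h : ContDiff ℝ ∞ φ) :
    Continuous (gradient φ) :=
  (InnerProductSpace.toDual ℝ Plane).symm.continuous.comp (h.continuous_fderiv (by simp))

theorem HasCompactSupport.gradient {φ : Plane → ℝ} (h : HasCompactSupport φ) :
    HasCompactSupport (gradient φ) :=
  (h.fderiv ℝ).comp_left (map_zero _)

theorem smoothCompactSupport_le_lipschitzSobolev (Ω : Set Plane) :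
    smoothCompactSupport ≤ lipschitzSobolev Ω := by
  rintro φ ⟨h1, h2⟩
  exact ⟨h1.lipschitzWith_of_hasCompactSupport h2 (by simp),
    (h1.continuous.memLp_of_hasCompactSupport h2).restrict Ω,
    ((continuous_gradient_of_contDiff h1).memLp_of_hasCompactSupport h2.gradient).restrict Ω⟩

/-- The restriction to `Ω` of smooth functions with compact support in the plane. -/
noncomputable def smoothToSobolev (Ω : Set Plane) : smoothCompactSupport →ₗ[ℝ] SobolevH1 Ω :=
  lipschitzToSobolev Ω ∘ₗ Submodule.inclusion (smoothCompactSupport_le_lipschitzSobolev Ω)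

/-! ### Mollification and dilation in `L²` -/

open scoped Convolution in
/-- Mollification by a bump function, followed by a dilation of ratio `1 - δ`. -/
noncomputable def dilatedMollification {F : Type*} [NormedAddCommGroup F] [NormedSpace ℝ F]
    (ψ : ContDiffBump (0 : Plane)) (δ : ℝ) (f : Plane → F) (x : Plane) : F :=
  (ψ.normed volume ⋆[ContinuousLinearMap.lsmul ℝ ℝ, volume] f) ((1 - δ) • x)

section

variable {F : Type*} [NormedAddCommGroup F] [NormedSpace ℝ F]

theorem lintegral_ofReal_normed_bump (ψ : ContDiffBump (0 : Plane)) :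
    ∫⁻ t, ENNReal.ofReal (ψ.normed volume t) = 1 := by
  rw [← ofReal_integral_eq_lintegral_ofReal ψ.integrable_normed
    (Filter.Eventually.of_forall fun t => ψ.nonneg_normed t), ψ.integral_normed,
    ENNReal.ofReal_one]

/-- The bump is a probability density, so the `L¹` norm for it is at most the `L²` norm. -/
theorem enorm_normed_convolution_sq_le (ψ : ContDiffBump (0 : Plane)) {h : Plane → F}
    (hh : AEStronglyMeasurable h volume) (x : Plane) :
    ‖(convolution (ψ.normed volume) h (ContinuousLinearMap.lsmul ℝ ℝ) volume) x‖ₑ ^ 2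
      ≤ ∫⁻ t, ENNReal.ofReal (ψ.normed volume t) * ‖h (x - t)‖ₑ ^ 2 := by
  set ν : Measure Plane := volume.withDensity (fun t => ENNReal.ofReal (ψ.normed volume t)) with hν
  have hmeas : Measurable (fun t => ENNReal.ofReal (ψ.normed volume t)) :=
    ψ.continuous_normed.measurable.ennreal_ofReal
  have : IsProbabilityMeasure ν := ⟨by
    rw [hν, withDensity_apply _ MeasurableSet.univ, Measure.restrict_univ,
      lintegral_ofReal_normed_bump]⟩
  have hx : AEStronglyMeasurable (fun t => h (x - t)) volume :=
    hh.comp_quasiMeasurePreserving (quasiMeasurePreserving_sub_left_of_right_invariant volume x)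
  have hxν : AEStronglyMeasurable (fun t => h (x - t)) ν :=
    hx.mono_ac (withDensity_absolutelyContinuous _ _)
  have h1 : ‖(convolution (ψ.normed volume) h (ContinuousLinearMap.lsmul ℝ ℝ) volume) x‖ₑ
      ≤ eLpNorm (fun t => h (x - t)) 1 ν := by
    rw [eLpNorm_one_eq_lintegral_enorm, hν,
      lintegral_withDensity_eq_lintegral_mul₀ hmeas.aemeasurable hx.enorm]
    refine (enorm_integral_le_lintegral_enorm _).trans (le_of_eq ?_)
    congr 1
    ext1 t
    simp only [ContinuousLinearMap.lsmul_apply, Pi.mul_apply]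
    rw [enorm_smul, Real.enorm_eq_ofReal (ψ.nonneg_normed t)]
  have h2 := h1.trans (eLpNorm_le_eLpNorm_of_exponent_le (p := 1) (q := 2) (by norm_num) hxν)
  calc _ ≤ eLpNorm (fun t => h (x - t)) 2 ν ^ 2 := by gcongr
    _ = ∫⁻ t, ‖h (x - t)‖ₑ ^ 2 ∂ν := (lintegral_enorm_sq_eq_eLpNorm_sq _ _).symm
    _ = _ := by
      rw [hν, lintegral_withDensity_eq_lintegral_mul₀ hmeas.aemeasurable (hx.enorm.pow_const 2)]
      rfl

theorem eLpNorm_normed_convolution_le (ψ : ContDiffBump (0 : Plane)) {h : Plane → F}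
    (hh : AEStronglyMeasurable h volume) :
    eLpNorm (convolution (ψ.normed volume) h (ContinuousLinearMap.lsmul ℝ ℝ) volume) 2 volume
      ≤ eLpNorm h 2 volume := by
  rw [← ENNReal.pow_le_pow_left_iff two_ne_zero, ← lintegral_enorm_sq_eq_eLpNorm_sq,
    ← lintegral_enorm_sq_eq_eLpNorm_sq]
  have hmeas : Measurable (fun t => ENNReal.ofReal (ψ.normed volume t)) :=
    ψ.continuous_normed.measurable.ennreal_ofReal
  calc _ ≤ ∫⁻ x, ∫⁻ t, ENNReal.ofReal (ψ.normed volume t) * ‖h (x - t)‖ₑ ^ 2 :=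
        lintegral_mono fun x => enorm_normed_convolution_sq_le ψ hh x
    _ = ∫⁻ t, ∫⁻ x, ENNReal.ofReal (ψ.normed volume t) * ‖h (x - t)‖ₑ ^ 2 := by
        apply lintegral_lintegral_swap
        apply AEMeasurable.mul (hmeas.comp measurable_snd).aemeasurable
        exact (hh.comp_quasiMeasurePreserving
          (quasiMeasurePreserving_sub volume volume)).enorm.pow_const 2
    _ = ∫⁻ t, ENNReal.ofReal (ψ.normed volume t) * ∫⁻ x, ‖h x‖ₑ ^ 2 := by
        congr 1
        ext1 t
        rw [lintegral_const_mul' _ _ ENNReal.ofReal_ne_top,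
          lintegral_sub_right_eq_self (fun x => ‖h x‖ₑ ^ 2) t]
    _ = _ := by
        rw [lintegral_mul_const _ hmeas, lintegral_ofReal_normed_bump, one_mul]

/-- In dimension two the dilation multiplies the `L²` norm by `r⁻¹ ≤ 2`. -/
theorem eLpNorm_comp_smul_le {F : Type*} [NormedAddCommGroup F] {r : ℝ} (hr : 1 / 2 ≤ r)
    {h : Plane → F} :
    eLpNorm (fun x => h (r • x)) 2 volume ≤ 2 * eLpNorm h 2 volume := by
  rw [← ENNReal.pow_le_pow_left_iff two_ne_zero, mul_pow, ← lintegral_enorm_sq_eq_eLpNorm_sq,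
    ← lintegral_enorm_sq_eq_eLpNorm_sq]
  have hr0 : 0 < r := by linarith
  have e : ∫⁻ x, ‖h (r • x)‖ₑ ^ 2 = ∫⁻ x, ‖h x‖ₑ ^ 2 ∂(Measure.map (r • ·) volume) :=
    ((Homeomorph.smulOfNeZero r hr0.ne').measurableEmbedding.lintegral_map
      (μ := volume) (fun x => ‖h x‖ₑ ^ 2)).symm
  rw [e, Measure.map_addHaar_smul volume hr0.ne', lintegral_smul_measure, smul_eq_mul]
  gcongr
  rw [finrank_euclideanSpace_fin, abs_of_pos (by positivity)]
  have : (2 : ENNReal) ^ 2 = ENNReal.ofReal 4 := by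
    rw [← ENNReal.ofReal_ofNat 2, ← ENNReal.ofReal_pow (by norm_num)]; norm_num
  rw [this]
  apply ENNReal.ofReal_le_ofReal
  rw [inv_le_comm₀ (by positivity) (by norm_num)]
  nlinarith

theorem eLpNorm_dilatedMollification_le (ψ : ContDiffBump (0 : Plane)) {δ : ℝ} (hδ : δ ≤ 1 / 2)
    {h : Plane → F} (hh : AEStronglyMeasurable h volume) :
    eLpNorm (dilatedMollification ψ δ h) 2 volume ≤ 2 * eLpNorm h 2 volume := by
  refine (eLpNorm_comp_smul_le (r := 1 - δ) (by linarith)).trans ?_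
  gcongr
  exact eLpNorm_normed_convolution_le ψ hh

theorem dilatedMollification_sub (ψ : ContDiffBump (0 : Plane)) (δ : ℝ)
    {f g : Plane → F} (hf : LocallyIntegrable f volume) (hg : LocallyIntegrable g volume) :
    dilatedMollification ψ δ (f - g)
      = dilatedMollification ψ δ f - dilatedMollification ψ δ g := by
  ext1 x
  have hex : ∀ k : Plane → F, LocallyIntegrable k volume →
      ConvolutionExistsAt (ψ.normed volume) k ((1 - δ) • x) (ContinuousLinearMap.lsmul ℝ ℝ)
        volume := fun k hk =>
    ψ.hasCompactSupport_normed.convolutionExists_left _ ψ.continuous_normed hk _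
  have h := (hex g hg).integrable
  have h' := (hex f hf).integrable
  simp only [dilatedMollification, Pi.sub_apply, convolution]
  rw [← integral_sub h' h]
  congr 1
  ext1 t
  rw [← map_sub]

theorem continuous_dilatedMollification (ψ : ContDiffBump (0 : Plane)) (δ : ℝ)
    {f : Plane → F} (hf : LocallyIntegrable f volume) :
    Continuous (dilatedMollification ψ δ f) := by
  have := (ψ.hasCompactSupport_normed (μ := volume)).continuous_convolution_left
    (ContinuousLinearMap.lsmul ℝ ℝ : ℝ →L[ℝ] F →L[ℝ] F) ψ.continuous_normed hf
  exact this.comp (continuous_const_smul (1 - δ))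

/-- The operators are bounded by `2` uniformly on `L²`, so it suffices to treat a continuous
compactly supported `g`, where uniform continuity applies. The threshold depends on `f` and `ε`
alone, so that one `δ` can serve both a function and its gradient. -/
theorem exists_eLpNorm_dilatedMollification_sub_le [CompleteSpace F] {Ω : Set Plane}
    (hΩm : MeasurableSet Ω) (hΩ : Ω ⊆ Metric.closedBall 0 1) {f : Plane → F} (hf : MemLp f 2 volume)
    {ε : ENNReal} (hε : ε ≠ 0) :
    ∃ δ₀ : ℝ, 0 < δ₀ ∧ δ₀ ≤ 1 / 2 ∧ ∀ (ψ : ContDiffBump (0 : Plane)) (δ : ℝ), 0 < δ → δ ≤ δ₀ →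
      ψ.rOut ≤ δ →
      eLpNorm (dilatedMollification ψ δ f - f) 2 (volume.restrict Ω) ≤ ε := by
  have hε4 : ε / 4 ≠ 0 := by simp [hε]
  obtain ⟨g, hgc, hfg, hgcont, hg⟩ := hf.exists_hasCompactSupport_eLpNorm_sub_le (by simp) hε4
  have hfin : IsFiniteMeasure (volume.restrict Ω) := ⟨by
    rw [Measure.restrict_apply_univ]
    exact (measure_mono hΩ).trans_lt measure_closedBall_lt_top⟩
  obtain ⟨η, hη, hηε⟩ : ∃ η : ℝ, 0 < η ∧
      (volume.restrict Ω) Set.univ ^ (2 : ENNReal).toReal⁻¹ * ENNReal.ofReal (2 * η) ≤ ε / 4 := by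
    set M := (volume.restrict Ω) Set.univ ^ (2 : ENNReal).toReal⁻¹ with hM
    have hMt : M ≠ ⊤ := ENNReal.rpow_ne_top_of_nonneg (by simp) (measure_ne_top _ _)
    have ht : Filter.Tendsto (fun η : ℝ => M * ENNReal.ofReal (2 * η)) (nhdsWithin 0 (Set.Ioi 0))
        (nhds 0) := by
      have : Filter.Tendsto (fun η : ℝ => M * ENNReal.ofReal (2 * η)) (nhds 0)
          (nhds (M * ENNReal.ofReal (2 * 0))) :=
        ENNReal.Tendsto.const_mul ((ENNReal.continuous_ofReal.comp
          (continuous_const.mul continuous_id)).tendsto 0) (Or.inr hMt)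
      rw [mul_zero, ENNReal.ofReal_zero, mul_zero] at this
      exact this.mono_left nhdsWithin_le_nhds
    have := (ht.eventually (gt_mem_nhds (pos_iff_ne_zero.2 hε4))).and self_mem_nhdsWithin
    obtain ⟨η, h1, h2⟩ := this.exists
    exact ⟨η, h2, h1.le⟩
  have huc := hgc.uniformContinuous_of_continuous hgcont
  obtain ⟨d, hd, hdg⟩ := Metric.uniformContinuous_iff.1 huc η hη
  -- On the unit disc both the mollification and the dilation move points by at most `δ ≤ d / 2 <
  -- d`, at a cost of `η` each.
  refine ⟨min (d / 2) (1 / 2), by positivity, min_le_right _ _, fun ψ δ hδ hδ₀ hψ => ?_⟩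
  have hδd : δ ≤ d / 2 := hδ₀.trans (min_le_left _ _)
  have hδ2 : δ ≤ 1 / 2 := hδ₀.trans (min_le_right _ _)
  have hfl := hf.locallyIntegrable (by norm_num)
  have hgl := hg.locallyIntegrable (by norm_num)
  have hsplit : dilatedMollification ψ δ f - f
      = dilatedMollification ψ δ (f - g) - (f - g) + (dilatedMollification ψ δ g - g) := by
    rw [dilatedMollification_sub ψ δ hfl hgl]
    abel
  have hm1 : AEStronglyMeasurable (dilatedMollification ψ δ (f - g)) volume :=
    (continuous_dilatedMollification ψ δ (hfl.sub hgl)).aestronglyMeasurable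
  have hm2 : AEStronglyMeasurable (dilatedMollification ψ δ g) volume :=
    (continuous_dilatedMollification ψ δ hgl).aestronglyMeasurable
  have hm3 : AEStronglyMeasurable (f - g) volume := hf.1.sub hg.1
  have b1 : eLpNorm (dilatedMollification ψ δ (f - g) - (f - g)) 2 (volume.restrict Ω)
      ≤ 2 * (ε / 4) + ε / 4 := by
    refine (eLpNorm_mono_measure _ Measure.restrict_le_self).trans ?_
    refine (eLpNorm_sub_le hm1 hm3 (by norm_num)).trans ?_
    gcongr
    refine (eLpNorm_dilatedMollification_le ψ hδ2 hm3).trans ?_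
    gcongr
  have b2 : eLpNorm (dilatedMollification ψ δ g - g) 2 (volume.restrict Ω) ≤ ε / 4 := by
    refine (eLpNorm_le_of_ae_bound (C := 2 * η) ?_).trans hηε
    filter_upwards [ae_restrict_mem hΩm] with x hx
    have hx1 : ‖x‖ ≤ 1 := mem_closedBall_zero_iff.1 (hΩ hx)
    have h1 : dist (dilatedMollification ψ δ g x) (g ((1 - δ) • x)) ≤ η :=
      ContDiffBump.dist_normed_convolution_le hgcont.aestronglyMeasurable fun y hy =>
        (hdg ((Metric.mem_ball.1 hy).trans_le (by linarith))).le
    have h2 : dist (g ((1 - δ) • x)) (g x) ≤ η := by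
      refine (hdg ?_).le
      have e : (1 - δ) • x - x = -(δ • x) := by module
      rw [dist_eq_norm, e, norm_neg, norm_smul, Real.norm_of_nonneg hδ.le]
      nlinarith
    rw [Pi.sub_apply, ← dist_eq_norm]
    linarith [dist_triangle (dilatedMollification ψ δ g x) (g ((1 - δ) • x)) (g x)]
  rw [hsplit]
  refine (eLpNorm_add_le ((hm1.sub hm3).restrict) ((hm2.sub hg.1).restrict) (by norm_num)).trans ?_
  refine (add_le_add b1 b2).trans (le_of_eq ?_)
  have : 2 * (ε / 4) + ε / 4 + ε / 4 = 4 * (ε / 4) := by ring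
  rw [this, ENNReal.mul_div_cancel (by norm_num) (by norm_num)]

end

/-! ### Density of smooth functions in the Sobolev space -/

theorem dilatedMollification_mem_smoothCompactSupport (ψ : ContDiffBump (0 : Plane)) {δ : ℝ}
    (hδ : δ < 1) {f : Plane → ℝ} (hf : LocallyIntegrable f volume) (hfc : HasCompactSupport f) :
    dilatedMollification ψ δ f ∈ smoothCompactSupport := by
  have h0 : (1 - δ) ≠ 0 := by linarith
  constructor
  · have := (ψ.hasCompactSupport_normed (μ := volume)).contDiff_convolution_left (n := ⊤)
      (ContinuousLinearMap.lsmul ℝ ℝ : ℝ →L[ℝ] ℝ →L[ℝ] ℝ) ψ.contDiff_normed hf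
    exact this.comp (contDiff_const_smul (1 - δ))
  · have := (ψ.hasCompactSupport_normed (μ := volume)).convolution
      (ContinuousLinearMap.lsmul ℝ ℝ : ℝ →L[ℝ] ℝ →L[ℝ] ℝ) (μ := volume) hfc
    exact this.comp_homeomorph (Homeomorph.smulOfNeZero (1 - δ) h0)

/-- For `x` in a convex set containing the ball of radius `a`, the ball of radius `δ a` around
`(1 - δ) x` is contained in the set. -/
theorem Convex.sub_mem_of_norm_lt {Ω : Set Plane} (hconv : Convex ℝ Ω) {a : ℝ}
    (ha : Metric.ball 0 a ⊆ Ω) {δ : ℝ} (hδ : 0 < δ) (hδ1 : δ ≤ 1) {x t : Plane} (hx : x ∈ Ω)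
    (ht : ‖t‖ < δ * a) : (1 - δ) • x - t ∈ Ω := by
  have h : -(δ⁻¹ • t) ∈ Ω := by
    apply ha
    rw [mem_ball_zero_iff, norm_neg, norm_smul, Real.norm_of_nonneg (by positivity),
      inv_mul_lt_iff₀ hδ]
    exact ht
  have := hconv hx h (by linarith : 0 ≤ 1 - δ) hδ.le (by ring)
  rwa [smul_neg, smul_inv_smul₀ hδ.ne', ← sub_eq_add_neg] at this

theorem fderiv_comp_const_sub_apply {k : Plane → ℝ} (hk : Differentiable ℝ k) (x₀ y w : Plane) :
    fderiv ℝ (fun y => k (x₀ - y)) y w = - fderiv ℝ k (x₀ - y) w := by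
  have h2 : HasFDerivAt (fun y => k (x₀ - y)) ((fderiv ℝ k (x₀ - y)).comp
      (-ContinuousLinearMap.id ℝ Plane)) y :=
    HasFDerivAt.comp y (hk _).hasFDerivAt ((hasFDerivAt_id y).const_sub x₀)
  rw [h2.fderiv]
  simp

/-- The translated bump `y ↦ ψ((1 - δ)x - y)` is supported in a small disc around `(1 - δ)x`, which
lies inside `Ω` by convexity. It is thus an admissible test function, and the cut-off of `u` at the
boundary is not seen. The factor `1 - δ` is the chain rule. -/
theorem gradient_dilatedMollification {Ω : Set Plane} (hΩm : MeasurableSet Ω)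
    (hconv : Convex ℝ Ω) {a : ℝ} (ha : Metric.ball 0 a ⊆ Ω)
    (ψ : ContDiffBump (0 : Plane)) {δ : ℝ} (hδ : 0 < δ) (hδ1 : δ ≤ 1) (hψ : ψ.rOut < δ * a)
    {u : Plane → ℝ} {g : Plane → Plane} (hu : LocallyIntegrable (Ω.indicator u) volume)
    (hg : LocallyIntegrable (Ω.indicator g) volume)
    (hug : IsWeakGradient Ω u g) {x : Plane} (hx : x ∈ Ω) :
    gradient (dilatedMollification ψ δ (Ω.indicator u)) x
      = (1 - δ) • dilatedMollification ψ δ (Ω.indicator g) x := by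
  set x₀ := (1 - δ) • x with hx₀
  have hψc : HasCompactSupport (ψ.normed volume) := ψ.hasCompactSupport_normed
  have hψs : ContDiff ℝ ∞ (ψ.normed volume) := ψ.contDiff_normed
  have hd := hψc.hasFDerivAt_convolution_left
    (ContinuousLinearMap.lsmul ℝ ℝ : ℝ →L[ℝ] ℝ →L[ℝ] ℝ) (hψs.of_le (by simp)) hu x₀
  have hd' : HasFDerivAt (dilatedMollification ψ δ (Ω.indicator u))
      ((convolution (fderiv ℝ (ψ.normed volume)) (Ω.indicator u)
        (ContinuousLinearMap.precompL Plane (ContinuousLinearMap.lsmul ℝ ℝ : ℝ →L[ℝ] ℝ →L[ℝ] ℝ))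
        volume x₀).comp ((1 - δ) • ContinuousLinearMap.id ℝ Plane)) x :=
    HasFDerivAt.comp x hd ((hasFDerivAt_id x).const_smul (1 - δ))
  refine ext_inner_right ℝ fun v => ?_
  rw [inner_gradient_left, hd'.fderiv, real_inner_smul_left]
  have hsub : ContDiff ℝ ∞ (fun y => x₀ - y) := contDiff_const.sub contDiff_id
  set φ : Plane → ℝ := fun y => ψ.normed volume (x₀ - y) with hφdef
  have hφ : IsTestFunction Ω φ := by
    refine ⟨hψs.comp hsub, ?_, ?_⟩
    · exact hψc.comp_homeomorph (Homeomorph.subLeft x₀)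
    · intro y hy
      have h0 : x₀ - y ∈ tsupport (ψ.normed volume) :=
        tsupport_comp_subset_preimage (ψ.normed volume) hsub.continuous hy
      rw [ψ.tsupport_normed_eq] at h0
      have h1 := mem_closedBall_zero_iff.1 h0
      have := hconv.sub_mem_of_norm_lt ha hδ hδ1 hx (h1.trans_lt hψ)
      rwa [← hx₀, sub_sub_cancel] at this
  have hfd : ∀ y w, fderiv ℝ φ y w = - fderiv ℝ (ψ.normed volume) (x₀ - y) w :=
    fderiv_comp_const_sub_apply (hψs.differentiable (by simp)) x₀
  have key := hug φ hφ v
  have hconvL : ConvolutionExistsAt (fderiv ℝ (ψ.normed volume)) (Ω.indicator u) x₀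
      (ContinuousLinearMap.precompL Plane (ContinuousLinearMap.lsmul ℝ ℝ : ℝ →L[ℝ] ℝ →L[ℝ] ℝ))
      volume :=
    (hψc.fderiv ℝ).convolutionExists_left _ (hψs.continuous_fderiv (by simp)) hu _
  have hconvR : ConvolutionExistsAt (ψ.normed volume) (Ω.indicator g) x₀
      (ContinuousLinearMap.lsmul ℝ ℝ : ℝ →L[ℝ] Plane →L[ℝ] Plane) volume :=
    hψc.convolutionExists_left _ hψs.continuous hg _
  have eL : (convolution (fderiv ℝ (ψ.normed volume)) (Ω.indicator u)
      (ContinuousLinearMap.precompL Plane (ContinuousLinearMap.lsmul ℝ ℝ : ℝ →L[ℝ] ℝ →L[ℝ] ℝ))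
      volume x₀) v = - ∫ y in Ω, u y * fderiv ℝ φ y v := by
    rw [convolution, ContinuousLinearMap.integral_apply hconvL.integrable, ← integral_neg,
      ← integral_indicator hΩm, ← integral_sub_left_eq_self _ volume x₀]
    congr 1
    ext1 y
    by_cases hy : y ∈ Ω
    · simp [hy, hfd, ContinuousLinearMap.precompL_apply, mul_comm]
    · simp [hy]
  have eR : ⟪dilatedMollification ψ δ (Ω.indicator g) x, v⟫ = ∫ y in Ω, ⟪g y, v⟫ * φ y := by
    rw [dilatedMollification, ← hx₀, convolution, real_inner_comm,
      ← integral_inner hconvR.integrable v, ← integral_indicator hΩm,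
      ← integral_sub_left_eq_self _ volume x₀]
    congr 1
    ext1 y
    by_cases hy : y ∈ Ω
    · simp [hy, hφdef, real_inner_smul_right, real_inner_comm, mul_comm]
    · simp [hy]
  rw [ContinuousLinearMap.comp_apply, eR]
  simp only [smul_apply, ContinuousLinearMap.id_apply, map_smul, smul_eq_mul]
  rw [eL, key, neg_neg]

/-- Smooth functions with compact support in the plane are dense in the Sobolev space of a
bounded open convex set. -/
theorem denseRange_smoothToSobolev {Ω : Set Plane} (hΩo : IsOpen Ω) (hconv : Convex ℝ Ω) {a : ℝ}
    (ha0 : 0 < a) (ha : Metric.ball 0 a ⊆ Ω) (hΩ : Ω ⊆ Metric.closedBall 0 1) :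
    DenseRange (smoothToSobolev Ω) := by
  have hΩm := hΩo.measurableSet
  intro w
  rw [Metric.mem_closure_iff]
  intro ε hε
  set u : Plane → ℝ := ⇑w.toLp with hu
  set g : Plane → Plane := ⇑w.grad with hg
  have hu2 : MemLp (Ω.indicator u) 2 volume := (memLp_indicator_iff_restrict hΩm).2 (Lp.memLp _)
  have hg2 : MemLp (Ω.indicator g) 2 volume := (memLp_indicator_iff_restrict hΩm).2 (Lp.memLp _)
  have hul := hu2.locallyIntegrable (by norm_num)
  have hgl := hg2.locallyIntegrable (by norm_num)
  have huc : HasCompactSupport (Ω.indicator u) :=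
    HasCompactSupport.intro (isCompact_closedBall 0 1)
      fun x hx => Set.indicator_of_notMem (fun h => hx (hΩ h)) _
  have hε' : ENNReal.ofReal (ε / 4) ≠ 0 := by simpa using hε
  obtain ⟨δ₁, h1, h1', H1⟩ := exists_eLpNorm_dilatedMollification_sub_le hΩm hΩ hu2 hε'
  obtain ⟨δ₂, h2, -, H2⟩ := exists_eLpNorm_dilatedMollification_sub_le hΩm hΩ hg2 hε'
  set N : ℝ := (eLpNorm (Ω.indicator g) 2 volume).toReal with hN
  have hN0 : 0 ≤ N := ENNReal.toReal_nonneg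
  have hNe : eLpNorm (Ω.indicator g) 2 volume = ENNReal.ofReal N :=
    (ENNReal.ofReal_toReal hg2.eLpNorm_ne_top).symm
  -- The third bound absorbs the factor `1 - δ` in the gradient, whose defect is at most `δ * (2 *
  -- N)`; `N + 1` avoids dividing by zero.
  set δ := min (min δ₁ δ₂) (ε / (8 * (N + 1))) with hδ
  have hδ0 : 0 < δ := by positivity
  have hδ1 : δ ≤ δ₁ := (min_le_left _ _).trans (min_le_left _ _)
  have hδ2 : δ ≤ δ₂ := (min_le_left _ _).trans (min_le_right _ _)
  have hδN : δ * (2 * N) ≤ ε / 4 := by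
    have : δ ≤ ε / (8 * (N + 1)) := min_le_right _ _
    calc δ * (2 * N) ≤ ε / (8 * (N + 1)) * (2 * (N + 1)) := by gcongr; linarith
      _ = ε / 4 := by field_simp; ring
  have hδh : δ ≤ 1 / 2 := hδ1.trans h1'
  set r := min (δ * a / 2) δ with hr
  have hr0 : 0 < r := by positivity
  let ψ : ContDiffBump (0 : Plane) := ⟨r / 2, r, by positivity, by linarith⟩
  have hψδ : ψ.rOut ≤ δ := min_le_right _ _
  have hψa : ψ.rOut < δ * a := (min_le_left _ _ : r ≤ δ * a / 2).trans_lt (by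
    have : 0 < δ * a := by positivity
    linarith)
  let φ : smoothCompactSupport := ⟨dilatedMollification ψ δ (Ω.indicator u),
    dilatedMollification_mem_smoothCompactSupport ψ (by linarith) hul huc⟩
  refine ⟨smoothToSobolev Ω φ, ⟨φ, rfl⟩, ?_⟩
  have B1 : ‖(w - smoothToSobolev Ω φ).toLp‖ ≤ ε / 4 := by
    refine ENNReal.toReal_le_of_le_ofReal (by positivity)
      (le_trans (le_of_eq ?_) (H1 ψ δ hδ0 hδ1 hψδ))
    rw [eLpNorm_sub_comm]
    apply eLpNorm_congr_ae
    have hφ := ((smoothCompactSupport_le_lipschitzSobolev Ω) φ.2).2.1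
    refine (Lp.coeFn_sub w.toLp hφ.toLp).trans ?_
    filter_upwards [hφ.coeFn_toLp, ae_restrict_mem hΩm] with x h1 h2
    simp only [Pi.sub_apply, h1, Set.indicator_of_mem h2]
    rfl
  have B2 : ‖(w - smoothToSobolev Ω φ).grad‖ ≤ ε / 2 := by
    have hb : eLpNorm (Ω.indicator g - (1 - δ) • dilatedMollification ψ δ (Ω.indicator g)) 2
        (volume.restrict Ω) ≤ ENNReal.ofReal (ε / 2) := by
      have e : Ω.indicator g - (1 - δ) • dilatedMollification ψ δ (Ω.indicator g)
          = -(dilatedMollification ψ δ (Ω.indicator g) - Ω.indicator g)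
            + δ • dilatedMollification ψ δ (Ω.indicator g) := by module
      have hm : AEStronglyMeasurable (dilatedMollification ψ δ (Ω.indicator g)) volume :=
        (continuous_dilatedMollification ψ δ hgl).aestronglyMeasurable
      rw [e]
      refine (eLpNorm_add_le ((hm.sub hg2.1).neg.restrict) ((hm.const_smul δ).restrict)
        (by norm_num)).trans ?_
      rw [eLpNorm_neg, show ε / 2 = ε / 4 + ε / 4 by ring,
        ENNReal.ofReal_add (by positivity) (by positivity)]
      gcongr
      · exact H2 ψ δ hδ0 hδ2 hψδ
      · refine (eLpNorm_mono_measure _ Measure.restrict_le_self).trans ?_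
        rw [eLpNorm_const_smul, Real.enorm_eq_ofReal hδ0.le]
        calc _ ≤ ENNReal.ofReal δ * (2 * ENNReal.ofReal N) := by
              gcongr
              rw [← hNe]
              exact eLpNorm_dilatedMollification_le ψ hδh hg2.1
          _ = ENNReal.ofReal (δ * (2 * N)) := by
              rw [ENNReal.ofReal_mul hδ0.le, ENNReal.ofReal_mul (by norm_num),
                ENNReal.ofReal_ofNat]
          _ ≤ _ := ENNReal.ofReal_le_ofReal hδN
    refine ENNReal.toReal_le_of_le_ofReal (by positivity) (le_trans (le_of_eq ?_) hb)
    apply eLpNorm_congr_ae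
    have hφ := ((smoothCompactSupport_le_lipschitzSobolev Ω) φ.2).2.2
    refine (Lp.coeFn_sub w.grad hφ.toLp).trans ?_
    filter_upwards [hφ.coeFn_toLp, ae_restrict_mem hΩm] with x h1 h2
    have h3 := gradient_dilatedMollification hΩm hconv ha ψ hδ0 (by linarith) hψa hul hgl w.2 h2
    simp only [Pi.sub_apply, Pi.smul_apply, h1, Set.indicator_of_mem h2]
    rw [← h3]
  rw [dist_eq_norm]
  have h : ‖w - smoothToSobolev Ω φ‖ ^ 2 = ‖(w - smoothToSobolev Ω φ).toLp‖ ^ 2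
      + ‖(w - smoothToSobolev Ω φ).grad‖ ^ 2 :=
    WithLp.prod_norm_sq_eq_of_L2 (w - smoothToSobolev Ω φ).1
  refine lt_of_pow_lt_pow_left₀ 2 hε.le ?_
  rw [h]
  have e1 := pow_le_pow_left₀ (norm_nonneg _) B1 2
  have e2 := pow_le_pow_left₀ (norm_nonneg _) B2 2
  nlinarith [sq_pos_of_pos hε]

/-! ### The extension by inversion in the gauge of a convex set -/

/-- The factor `max (gauge Ω x) 1 ^ (-2)`. -/
noncomputable def foldFactor (Ω : Set Plane) (x : Plane) : ℝ := (max (gauge Ω x) 1 ^ 2)⁻¹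

/-- The retraction of the plane onto the closure of `Ω` which is the inversion in the gauge of `Ω`
outside `Ω`. -/
noncomputable def foldMap (Ω : Set Plane) (x : Plane) : Plane := foldFactor Ω x • x

/-- The extension of `φ` from `Ω` to the plane by means of the inversion in the gauge of `Ω`. -/
noncomputable def foldExtension (Ω : Set Plane) (φ : Plane → ℝ) (x : Plane) : ℝ :=
  foldFactor Ω x * φ (foldMap Ω x)

theorem foldFactor_pos (Ω : Set Plane) (x : Plane) : 0 < foldFactor Ω x := by
  have : (1 : ℝ) ≤ max (gauge Ω x) 1 := le_max_right _ _
  unfold foldFactor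
  positivity

theorem foldFactor_le_one (Ω : Set Plane) (x : Plane) : foldFactor Ω x ≤ 1 :=
  inv_le_one_of_one_le₀ (one_le_pow₀ (le_max_right _ _))

/-- The extra factor `t` is needed for `foldMap`, where the variation of `foldFactor` multiplies a
point whose norm is only controlled by its gauge. -/
theorem abs_inv_sq_sub_inv_sq_le {s t : ℝ} (hs : 1 ≤ s) (ht : 1 ≤ t) :
    |(s ^ 2)⁻¹ - (t ^ 2)⁻¹| * t ≤ 2 * |s - t| := by
  have e : (s ^ 2)⁻¹ - (t ^ 2)⁻¹ = (t - s) * ((s + t) / (s ^ 2 * t ^ 2)) := by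
    field_simp; ring
  rw [e, abs_mul, abs_of_nonneg (by positivity : 0 ≤ (s + t) / (s ^ 2 * t ^ 2)), abs_sub_comm,
    mul_assoc, mul_comm]
  gcongr
  have : (s + t) / (s ^ 2 * t ^ 2) * t = (s + t) / (s ^ 2 * t) := by field_simp
  rw [this, div_le_iff₀ (by positivity)]
  nlinarith [mul_nonneg (sub_nonneg.2 hs) (sub_nonneg.2 ht), mul_nonneg (sub_nonneg.2 hs)
    (mul_nonneg (by linarith : 0 ≤ s) (by linarith : 0 ≤ t))]

section

variable {Ω : Set Plane} {a : ℝ}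

theorem norm_le_gauge_of_subset_closedBall (ha0 : 0 < a) (ha : Metric.ball 0 a ⊆ Ω)
    (hΩ : Ω ⊆ Metric.closedBall 0 1) (x : Plane) : ‖x‖ ≤ gauge Ω x := by
  have := le_gauge_of_subset_closedBall (x := x)
    (absorbent_nhds_zero (Filter.mem_of_superset (Metric.ball_mem_nhds 0 ha0) ha)) zero_le_one hΩ
  simpa using this

theorem Convex.abs_gauge_sub_gauge_le (hconv : Convex ℝ Ω) (ha0 : 0 < a)
    (ha : Metric.ball 0 a ⊆ Ω) (x y : Plane) : |gauge Ω x - gauge Ω y| ≤ a⁻¹ * ‖x - y‖ := by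
  have := (hconv.lipschitzWith_gauge (r := ⟨a, ha0.le⟩) ha0 ha).dist_le_mul x y
  rw [Real.dist_eq, dist_eq_norm] at this
  exact this

theorem Convex.abs_foldFactor_sub_mul_le (hconv : Convex ℝ Ω) (ha0 : 0 < a)
    (ha : Metric.ball 0 a ⊆ Ω) (x y : Plane) :
    |foldFactor Ω x - foldFactor Ω y| * max (gauge Ω y) 1 ≤ 2 * (a⁻¹ * ‖x - y‖) := by
  refine (abs_inv_sq_sub_inv_sq_le (le_max_right _ _) (le_max_right _ _)).trans ?_
  gcongr
  exact (abs_max_sub_max_le_abs _ _ _).trans (hconv.abs_gauge_sub_gauge_le ha0 ha x y)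

theorem Convex.norm_foldMap_sub_le (hconv : Convex ℝ Ω) (ha0 : 0 < a)
    (ha : Metric.ball 0 a ⊆ Ω) (hΩ : Ω ⊆ Metric.closedBall 0 1) (x y : Plane) :
    ‖foldMap Ω x - foldMap Ω y‖ ≤ (1 + 2 * a⁻¹) * ‖x - y‖ := by
  have e : foldMap Ω x - foldMap Ω y
      = foldFactor Ω x • (x - y) + (foldFactor Ω x - foldFactor Ω y) • y := by
    simp only [foldMap]; module
  rw [e]
  refine (norm_add_le _ _).trans ?_
  rw [norm_smul, norm_smul, Real.norm_eq_abs, Real.norm_eq_abs, abs_of_pos (foldFactor_pos Ω x)]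
  have h1 : foldFactor Ω x * ‖x - y‖ ≤ 1 * ‖x - y‖ := by
    gcongr; exact foldFactor_le_one Ω x
  have h2 : |foldFactor Ω x - foldFactor Ω y| * ‖y‖
      ≤ |foldFactor Ω x - foldFactor Ω y| * max (gauge Ω y) 1 := by
    gcongr
    exact (norm_le_gauge_of_subset_closedBall ha0 ha hΩ y).trans (le_max_left _ _)
  linarith [hconv.abs_foldFactor_sub_mul_le ha0 ha x y]

theorem Convex.exists_lipschitzWith_foldExtension (hconv : Convex ℝ Ω) (ha0 : 0 < a)
    (ha : Metric.ball 0 a ⊆ Ω) (hΩ : Ω ⊆ Metric.closedBall 0 1) {φ : Plane → ℝ}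
    (hφ : φ ∈ smoothCompactSupport) : ∃ C, LipschitzWith C (foldExtension Ω φ) := by
  obtain ⟨D, hD⟩ := hφ.1.lipschitzWith_of_hasCompactSupport hφ.2 (by simp)
  obtain ⟨M, hM⟩ := hφ.2.exists_bound_of_continuous hφ.1.continuous
  have hM0 : 0 ≤ M := (norm_nonneg _).trans (hM 0)
  refine ⟨_, LipschitzWith.of_dist_le' (K := D * (1 + 2 * a⁻¹) + 2 * a⁻¹ * M) fun x y => ?_⟩
  have e : foldExtension Ω φ x - foldExtension Ω φ y
      = foldFactor Ω x * (φ (foldMap Ω x) - φ (foldMap Ω y))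
        + (foldFactor Ω x - foldFactor Ω y) * φ (foldMap Ω y) := by
    simp only [foldExtension]; ring
  rw [Real.dist_eq, e, dist_eq_norm]
  refine (abs_add_le _ _).trans ?_
  rw [abs_mul, abs_mul, abs_of_pos (foldFactor_pos Ω x)]
  have h1 : foldFactor Ω x * |φ (foldMap Ω x) - φ (foldMap Ω y)|
      ≤ 1 * (D * ((1 + 2 * a⁻¹) * ‖x - y‖)) := by
    gcongr
    · exact foldFactor_le_one Ω x
    · have := hD.dist_le_mul (foldMap Ω x) (foldMap Ω y)
      rw [Real.dist_eq, dist_eq_norm] at this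
      refine this.trans ?_
      gcongr
      exact hconv.norm_foldMap_sub_le ha0 ha hΩ x y
  have h2 : |foldFactor Ω x - foldFactor Ω y| * |φ (foldMap Ω y)|
      ≤ (2 * (a⁻¹ * ‖x - y‖)) * M := by
    gcongr
    · refine le_trans ?_ (hconv.abs_foldFactor_sub_mul_le ha0 ha x y)
      exact le_mul_of_one_le_right (abs_nonneg _) (le_max_right _ _)
    · exact hM _
  refine (add_le_add h1 h2).trans (le_of_eq ?_)
  ring

/-! #### Differentiation outside the convex set -/

/-- Euler's identity for a function homogeneous of degree one: differentiate along the ray through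
`x`. -/
theorem fderiv_gauge_self {x : Plane} (h : DifferentiableAt ℝ (gauge Ω) x) :
    fderiv ℝ (gauge Ω) x x = gauge Ω x := by
  have h1 : HasDerivAt (fun t : ℝ => gauge Ω (t • x)) (fderiv ℝ (gauge Ω) x x) 1 := by
    have hl : HasDerivAt (fun t : ℝ => t • x) x 1 := by
      simpa using (hasDerivAt_id (1 : ℝ)).smul_const x
    have hf : HasFDerivAt (gauge Ω) (fderiv ℝ (gauge Ω) x) ((1 : ℝ) • x) := by
      rw [one_smul]; exact h.hasFDerivAt
    exact hf.comp_hasDerivAt (1 : ℝ) hl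
  have h2 : HasDerivAt (fun t : ℝ => gauge Ω (t • x)) (gauge Ω x) 1 := by
    have hl : HasDerivAt (fun t : ℝ => t * gauge Ω x) (gauge Ω x) 1 := by
      simpa using (hasDerivAt_id (1 : ℝ)).mul_const (gauge Ω x)
    refine hl.congr_of_eventuallyEq ?_
    filter_upwards [lt_mem_nhds (zero_lt_one : (0 : ℝ) < 1)] with t ht
    rw [gauge_smul_of_nonneg ht.le, smul_eq_mul]
  exact h1.unique h2

theorem Convex.norm_gradient_gauge_le (hconv : Convex ℝ Ω) (ha0 : 0 < a)
    (ha : Metric.ball 0 a ⊆ Ω) (x : Plane) : ‖gradient (gauge Ω) x‖ ≤ a⁻¹ := by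
  rw [gradient, LinearIsometryEquiv.norm_map]
  exact norm_fderiv_le_of_lipschitz ℝ (hconv.lipschitzWith_gauge (r := ⟨a, ha0.le⟩) ha0 ha)

theorem Convex.foldFactor_eventuallyEq (hconv : Convex ℝ Ω) (ha0 : 0 < a)
    (ha : Metric.ball 0 a ⊆ Ω) {x : Plane} (hx : 1 < gauge Ω x) :
    foldFactor Ω =ᶠ[nhds x] fun z => (gauge Ω z ^ 2)⁻¹ := by
  have hc := (hconv.lipschitzWith_gauge (r := ⟨a, ha0.le⟩) ha0 ha).continuous
  filter_upwards [hc.continuousAt.eventually (lt_mem_nhds hx)] with z hz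
  rw [foldFactor, max_eq_left hz.le]

theorem foldFactor_of_one_lt {x : Plane} (hx : 1 < gauge Ω x) :
    foldFactor Ω x = (gauge Ω x ^ 2)⁻¹ := by
  rw [foldFactor, max_eq_left hx.le]

theorem Convex.hasFDerivAt_foldFactor (hconv : Convex ℝ Ω) (ha0 : 0 < a)
    (ha : Metric.ball 0 a ⊆ Ω) {x : Plane} (hx : 1 < gauge Ω x)
    (hd : DifferentiableAt ℝ (gauge Ω) x) :
    HasFDerivAt (foldFactor Ω) ((-(2 * (gauge Ω x ^ 3)⁻¹)) • fderiv ℝ (gauge Ω) x) x := by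
  have h0 : gauge Ω x ≠ 0 := by linarith
  have h1 : HasDerivAt (fun t : ℝ => (t ^ 2)⁻¹) (-(2 * (gauge Ω x ^ 3)⁻¹)) (gauge Ω x) := by
    have := (hasDerivAt_pow 2 (gauge Ω x)).inv (pow_ne_zero 2 h0)
    refine this.congr_deriv ?_
    simp
    field_simp
  exact (h1.comp_hasFDerivAt x hd.hasFDerivAt).congr_of_eventuallyEq
    (hconv.foldFactor_eventuallyEq ha0 ha hx)

theorem Convex.hasFDerivAt_foldMap (hconv : Convex ℝ Ω) (ha0 : 0 < a)
    (ha : Metric.ball 0 a ⊆ Ω) {x : Plane} (hx : 1 < gauge Ω x)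
    (hd : DifferentiableAt ℝ (gauge Ω) x) :
    HasFDerivAt (foldMap Ω) ((gauge Ω x ^ 2)⁻¹ • (ContinuousLinearMap.id ℝ Plane
      - (2 : ℝ) • (fderiv ℝ (gauge Ω) x).smulRight ((gauge Ω x)⁻¹ • x))) x := by
  have h0 : gauge Ω x ≠ 0 := by linarith
  have h := (hconv.hasFDerivAt_foldFactor ha0 ha hx hd).smul (hasFDerivAt_id x)
  refine h.congr_fderiv ?_
  rw [foldFactor_of_one_lt hx]
  ext1 v
  simp only [id_eq, add_apply, smul_apply, sub_apply, ContinuousLinearMap.id_apply,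
    ContinuousLinearMap.smulRight_apply, smul_sub, smul_smul, smul_eq_mul]
  rw [sub_eq_add_neg, ← neg_smul]
  congr 2
  field_simp

theorem Convex.gradient_foldExtension (hconv : Convex ℝ Ω) (ha0 : 0 < a)
    (ha : Metric.ball 0 a ⊆ Ω) {x : Plane} (hx : 1 < gauge Ω x)
    (hd : DifferentiableAt ℝ (gauge Ω) x) {φ : Plane → ℝ} (hφ : Differentiable ℝ φ) :
    gradient (foldExtension Ω φ) x
      = (gauge Ω x ^ 4)⁻¹ • (gradient φ (foldMap Ω x)
          - (2 * ⟪gradient φ (foldMap Ω x), (gauge Ω x)⁻¹ • x⟫) • gradient (gauge Ω) x)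
        - (2 * (gauge Ω x ^ 3)⁻¹ * φ (foldMap Ω x)) • gradient (gauge Ω) x := by
  have h0 : gauge Ω x ≠ 0 := by linarith
  have h : HasFDerivAt (foldExtension Ω φ) _ x :=
    (hconv.hasFDerivAt_foldFactor ha0 ha hx hd).mul
    (HasFDerivAt.comp x (hφ (foldMap Ω x)).hasFDerivAt (hconv.hasFDerivAt_foldMap ha0 ha hx hd))
  refine ext_inner_right ℝ fun v => ?_
  rw [inner_gradient_left, h.fderiv, foldFactor_of_one_lt hx]
  simp only [add_apply, smul_apply, sub_apply, ContinuousLinearMap.id_apply,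
    ContinuousLinearMap.smulRight_apply, smul_eq_mul, ContinuousLinearMap.comp_apply,
    inner_sub_left, real_inner_smul_left, inner_gradient_left, map_sub, map_smul]
  field_simp
  ring

/-- Young's inequality with weights `1 + 2` and `1 + 1/2`; with these, `3L` and `6/a² + 1` coincide
when `a² = 3/4` and `L = 3`. -/
theorem norm_sub_sq_le_three_mul (p q : Plane) :
    ‖p - q‖ ^ 2 ≤ 3 * ‖p‖ ^ 2 + 3 / 2 * ‖q‖ ^ 2 := by
  have h := norm_sub_le p q
  have h2 : ‖p - q‖ ^ 2 ≤ (‖p‖ + ‖q‖) ^ 2 := by gcongr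
  nlinarith [sq_nonneg (2 * ‖p‖ - ‖q‖)]

/-- The factor `R⁻⁴` is kept on the right because it is the Jacobian of the inversion. The gradient
terms carry `R⁻⁸` and `R⁻⁶`, which are smaller since `R > 1`. The coefficient of `φ²` is `1` from
the function itself plus `(3/2) · 4 · a⁻²` from the gradient of the weight. -/
theorem Convex.energy_density_foldExtension_le (hconv : Convex ℝ Ω) (ha0 : 0 < a)
    (ha : Metric.ball 0 a ⊆ Ω) (hΩ : Ω ⊆ Metric.closedBall 0 1) {L K : ℝ} (hL : 1 ≤ L)
    (hLa : (4 * (a ^ 2)⁻¹ - 2) * L ≤ L ^ 2 + 1) (hLK : 3 * L ≤ K) (hK : 6 * (a ^ 2)⁻¹ + 1 ≤ K)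
    {x : Plane} (hx : 1 < gauge Ω x)
    (hd : DifferentiableAt ℝ (gauge Ω) x) {φ : Plane → ℝ} (hφ : Differentiable ℝ φ) :
    foldExtension Ω φ x ^ 2 + ‖gradient (foldExtension Ω φ) x‖ ^ 2
      ≤ (gauge Ω x ^ 4)⁻¹ * (K * (φ (foldMap Ω x) ^ 2 + ‖gradient φ (foldMap Ω x)‖ ^ 2)) := by
  rw [hconv.gradient_foldExtension ha0 ha hx hd hφ, foldExtension, foldFactor_of_one_lt hx]
  have hfx := fderiv_gauge_self hd
  have hm := hconv.norm_gradient_gauge_le ha0 ha x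
  have hxg := norm_le_gauge_of_subset_closedBall ha0 ha hΩ x
  set R := gauge Ω x with hR
  set m := gradient (gauge Ω) x with hmdef
  set G := gradient φ (foldMap Ω x)
  set f := φ (foldMap Ω x)
  have hR0 : 0 < R := by linarith
  have hinner : ⟪m, R⁻¹ • x⟫ = 1 := by
    rw [hmdef, inner_gradient_left, map_smul, hfx, smul_eq_mul, inv_mul_cancel₀ hR0.ne']
  have hy : ‖R⁻¹ • x‖ ^ 2 ≤ 1 := by
    rw [norm_smul, Real.norm_of_nonneg (by positivity), inv_mul_eq_div]
    exact pow_le_one₀ (by positivity) ((div_le_one hR0).2 hxg)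
  have hm2 : ‖m‖ ^ 2 ≤ (a ^ 2)⁻¹ := by
    rw [← inv_pow]; gcongr
  have hrefl := norm_sq_sub_smul_le_of_inner_eq_one hL hinner (by
    refine le_trans ?_ hLa
    have : ‖m‖ ^ 2 * ‖R⁻¹ • x‖ ^ 2 ≤ (a ^ 2)⁻¹ * 1 := by gcongr
    gcongr
    linarith) G
  set H := G - (2 * ⟪G, R⁻¹ • x⟫) • m
  have hsplit := norm_sub_sq_le_three_mul ((R ^ 4)⁻¹ • H) ((2 * (R ^ 3)⁻¹ * f) • m)
  rw [norm_smul, norm_smul, mul_pow, mul_pow, Real.norm_eq_abs, Real.norm_eq_abs, sq_abs, sq_abs]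
    at hsplit
  set q := (R ^ 4)⁻¹ with hq
  have hq0 : 0 < q := by positivity
  have hq1 : q ≤ 1 := inv_le_one_of_one_le₀ (one_le_pow₀ hx.le)
  have e1 : ((R ^ 2)⁻¹ * f) ^ 2 = q * f ^ 2 := by rw [hq, mul_pow, ← inv_pow, ← inv_pow]; ring
  have e2 : (2 * (R ^ 3)⁻¹ * f) ^ 2 ≤ 4 * q * f ^ 2 := by
    have : ((R ^ 3)⁻¹) ^ 2 ≤ q := by
      rw [hq, ← inv_pow, ← pow_mul, ← inv_pow]
      exact pow_le_pow_of_le_one (by positivity) (inv_le_one_of_one_le₀ hx.le) (by norm_num)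
    calc (2 * (R ^ 3)⁻¹ * f) ^ 2 = 4 * ((R ^ 3)⁻¹) ^ 2 * f ^ 2 := by ring
      _ ≤ 4 * q * f ^ 2 := by gcongr
  have e3 : q ^ 2 * ‖H‖ ^ 2 ≤ q * (L * ‖G‖ ^ 2) := by
    have : q ^ 2 ≤ q := by nlinarith
    gcongr
  have e4 : (2 * (R ^ 3)⁻¹ * f) ^ 2 * ‖m‖ ^ 2 ≤ 4 * q * f ^ 2 * (a ^ 2)⁻¹ := by gcongr
  have e5 : q * (3 * L * ‖G‖ ^ 2) ≤ q * (K * ‖G‖ ^ 2) := by gcongr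
  have e6 : q * ((6 * (a ^ 2)⁻¹ + 1) * f ^ 2) ≤ q * (K * f ^ 2) := by gcongr
  rw [e1]
  linarith

end

/-! #### The energy of the extension -/

section

variable {Ω : Set Plane} {a : ℝ}

theorem gauge_foldMap {x : Plane} (hx : 1 < gauge Ω x) :
    gauge Ω (foldMap Ω x) = (gauge Ω x)⁻¹ := by
  have h0 : gauge Ω x ≠ 0 := by linarith
  rw [foldMap, gauge_smul_of_nonneg (foldFactor_pos Ω x).le, foldFactor_of_one_lt hx, smul_eq_mul]
  field_simp

theorem injOn_foldMap : Set.InjOn (foldMap Ω) {x | 1 < gauge Ω x} := by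
  intro x hx y hy hxy
  have hg : gauge Ω x = gauge Ω y := by
    rw [← inv_inj, ← gauge_foldMap hx, ← gauge_foldMap hy, hxy]
  simp only [foldMap, foldFactor, hg] at hxy
  exact smul_right_injective Plane (foldFactor_pos Ω y).ne' hxy

theorem Convex.foldMap_mem (hconv : Convex ℝ Ω) (ha0 : 0 < a)
    (ha : Metric.ball 0 a ⊆ Ω) {x : Plane} (hx : 1 < gauge Ω x) : foldMap Ω x ∈ Ω := by
  have hn : Ω ∈ nhds (0 : Plane) := Filter.mem_of_superset (Metric.ball_mem_nhds 0 ha0) ha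
  refine interior_subset ((gauge_lt_one_iff_mem_interior hconv hn).1 ?_)
  rw [gauge_foldMap hx]
  exact inv_lt_one_of_one_lt₀ hx

theorem Convex.foldExtension_of_mem (hconv : Convex ℝ Ω) (hΩo : IsOpen Ω) (ha0 : 0 < a)
    (ha : Metric.ball 0 a ⊆ Ω) (φ : Plane → ℝ) {x : Plane} (hx : x ∈ Ω) :
    foldExtension Ω φ x = φ x := by
  have hn : Ω ∈ nhds (0 : Plane) := Filter.mem_of_superset (Metric.ball_mem_nhds 0 ha0) ha
  rw [← hΩo.interior_eq, ← gauge_lt_one_iff_mem_interior hconv hn] at hx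
  simp [foldExtension, foldMap, foldFactor, max_eq_right hx.le]

theorem Convex.gradient_foldExtension_of_mem (hconv : Convex ℝ Ω) (hΩo : IsOpen Ω) (ha0 : 0 < a)
    (ha : Metric.ball 0 a ⊆ Ω) (φ : Plane → ℝ) {x : Plane} (hx : x ∈ Ω) :
    gradient (foldExtension Ω φ) x = gradient φ x := by
  refine Filter.EventuallyEq.gradient_eq ?_
  filter_upwards [hΩo.mem_nhds hx] with z hz
  exact hconv.foldExtension_of_mem hΩo ha0 ha φ hz

/-- The boundary of a convex set is null, and the gauge is Lipschitz, hence differentiable almost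
everywhere. -/
theorem Convex.ae_one_lt_gauge_of_notMem (hconv : Convex ℝ Ω) (hΩo : IsOpen Ω) (ha0 : 0 < a)
    (ha : Metric.ball 0 a ⊆ Ω) :
    ∀ᵐ x : Plane, x ∉ Ω → 1 < gauge Ω x ∧ DifferentiableAt ℝ (gauge Ω) x := by
  have hn : Ω ∈ nhds (0 : Plane) := Filter.mem_of_superset (Metric.ball_mem_nhds 0 ha0) ha
  filter_upwards [(hconv.lipschitzWith_gauge (r := ⟨a, ha0.le⟩) ha0 ha).ae_differentiableAt
    (μ := volume), measure_eq_zero_iff_ae_notMem.1 (hconv.addHaar_frontier volume)] with x h1 h2 h3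
  refine ⟨lt_of_le_of_ne ?_ fun h => h2 ((gauge_eq_one_iff_mem_frontier hconv hn).1 h.symm), h1⟩
  rw [← not_lt, gauge_lt_one_iff_mem_interior hconv hn, hΩo.interior_eq]
  exact h3

theorem enorm_sq_add_enorm_sq_eq (r : ℝ) (v : Plane) :
    ‖r‖ₑ ^ 2 + ‖v‖ₑ ^ 2 = ENNReal.ofReal (r ^ 2 + ‖v‖ ^ 2) := by
  rw [ENNReal.ofReal_add (by positivity) (by positivity), ← sq_abs, ← Real.norm_eq_abs,
    ENNReal.ofReal_pow (norm_nonneg _), ENNReal.ofReal_pow (norm_nonneg _), ofReal_norm,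
    ofReal_norm]

/-- The pointwise bound is integrated by the change of variables `foldMap`, injective outside the
closure of `Ω` with image in `Ω`. -/
theorem Convex.lintegral_compl_energy_foldExtension_le (hconv : Convex ℝ Ω) (hΩo : IsOpen Ω)
    (ha0 : 0 < a) (ha : Metric.ball 0 a ⊆ Ω) (hΩ : Ω ⊆ Metric.closedBall 0 1) {L K : ℝ}
    (hL : 1 ≤ L) (hLa : (4 * (a ^ 2)⁻¹ - 2) * L ≤ L ^ 2 + 1) (hLK : 3 * L ≤ K)
    (hK : 6 * (a ^ 2)⁻¹ + 1 ≤ K) {φ : Plane → ℝ} (hφ : Differentiable ℝ φ) :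
    ∫⁻ x in Ωᶜ, (‖foldExtension Ω φ x‖ₑ ^ 2 + ‖gradient (foldExtension Ω φ) x‖ₑ ^ 2)
      ≤ ENNReal.ofReal K * ∫⁻ x in Ω, (‖φ x‖ₑ ^ 2 + ‖gradient φ x‖ₑ ^ 2) := by
  set S : Set Plane := {x | 1 < gauge Ω x} ∩ {x | DifferentiableAt ℝ (gauge Ω) x} with hS
  have hc := (hconv.lipschitzWith_gauge (r := ⟨a, ha0.le⟩) ha0 ha).continuous
  have hSm : MeasurableSet S :=
    (measurableSet_lt measurable_const hc.measurable).inter (measurableSet_of_differentiableAt ℝ _)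
  have hΩS : (Ωᶜ : Set Plane) ≤ᵐ[volume] S := by
    filter_upwards [hconv.ae_one_lt_gauge_of_notMem hΩo ha0 ha] with x hx hxΩ
    exact hx hxΩ
  have hK0 : 0 ≤ K := by linarith
  set f' : Plane → Plane →L[ℝ] Plane := fun x => (gauge Ω x ^ 2)⁻¹ •
    (ContinuousLinearMap.id ℝ Plane
      - (2 : ℝ) • (fderiv ℝ (gauge Ω) x).smulRight ((gauge Ω x)⁻¹ • x)) with hf'
  have hdet : ∀ x ∈ S, |(f' x).det| = (gauge Ω x ^ 4)⁻¹ := by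
    intro x hx
    have h0 : gauge Ω x ≠ 0 := by linarith [hx.1.out]
    rw [hf', det_smul_id_sub_smulRight, abs_neg, abs_of_nonneg (by positivity), ← inv_pow,
      ← inv_pow, ← pow_mul]
    rw [map_smul, fderiv_gauge_self hx.2, smul_eq_mul, inv_mul_cancel₀ h0]
  calc _ ≤ ∫⁻ x in S, (‖foldExtension Ω φ x‖ₑ ^ 2 + ‖gradient (foldExtension Ω φ) x‖ₑ ^ 2) :=
        lintegral_mono_set' hΩS
    _ ≤ ∫⁻ x in S, ENNReal.ofReal |(f' x).det| * (ENNReal.ofReal K *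
          (‖φ (foldMap Ω x)‖ₑ ^ 2 + ‖gradient φ (foldMap Ω x)‖ₑ ^ 2)) := by
        refine setLIntegral_mono' hSm fun x hx => ?_
        rw [hdet x hx, enorm_sq_add_enorm_sq_eq, enorm_sq_add_enorm_sq_eq,
          ← ENNReal.ofReal_mul hK0, ← ENNReal.ofReal_mul (by positivity)]
        exact ENNReal.ofReal_le_ofReal
          (hconv.energy_density_foldExtension_le ha0 ha hΩ hL hLa hLK hK hx.1 hx.2 hφ)
    _ = ∫⁻ y in foldMap Ω '' S, ENNReal.ofReal K * (‖φ y‖ₑ ^ 2 + ‖gradient φ y‖ₑ ^ 2) :=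
        (lintegral_image_eq_lintegral_abs_det_fderiv_mul volume hSm
          (fun x hx => (hconv.hasFDerivAt_foldMap ha0 ha hx.1 hx.2).hasFDerivWithinAt)
          (injOn_foldMap.mono Set.inter_subset_left)
          (fun y => ENNReal.ofReal K * (‖φ y‖ₑ ^ 2 + ‖gradient φ y‖ₑ ^ 2))).symm
    _ ≤ ∫⁻ y in Ω, ENNReal.ofReal K * (‖φ y‖ₑ ^ 2 + ‖gradient φ y‖ₑ ^ 2) := by
        refine lintegral_mono_set ?_
        rintro _ ⟨x, hx, rfl⟩
        exact hconv.foldMap_mem ha0 ha hx.1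
    _ = _ := lintegral_const_mul' _ _ ENNReal.ofReal_ne_top

theorem Convex.lintegral_energy_foldExtension_le (hconv : Convex ℝ Ω) (hΩo : IsOpen Ω)
    (ha0 : 0 < a) (ha : Metric.ball 0 a ⊆ Ω) (hΩ : Ω ⊆ Metric.closedBall 0 1) {L K : ℝ}
    (hL : 1 ≤ L) (hLa : (4 * (a ^ 2)⁻¹ - 2) * L ≤ L ^ 2 + 1) (hLK : 3 * L ≤ K)
    (hK : 6 * (a ^ 2)⁻¹ + 1 ≤ K) {φ : Plane → ℝ} (hφ : Differentiable ℝ φ) :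
    ∫⁻ x, (‖foldExtension Ω φ x‖ₑ ^ 2 + ‖gradient (foldExtension Ω φ) x‖ₑ ^ 2)
      ≤ ENNReal.ofReal (1 + K) * ∫⁻ x in Ω, (‖φ x‖ₑ ^ 2 + ‖gradient φ x‖ₑ ^ 2) := by
  have hK0 : 0 ≤ K := by linarith
  rw [← lintegral_add_compl _ hΩo.measurableSet, ENNReal.ofReal_add zero_le_one hK0, add_mul,
    ENNReal.ofReal_one, one_mul]
  gcongr ?_ + ?_
  · refine le_of_eq (setLIntegral_congr_fun hΩo.measurableSet fun x hx => ?_)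
    simp only [hconv.foldExtension_of_mem hΩo ha0 ha φ hx,
      hconv.gradient_foldExtension_of_mem hΩo ha0 ha φ hx]
  · exact hconv.lintegral_compl_energy_foldExtension_le hΩo ha0 ha hΩ hL hLa hLK hK hφ

theorem Convex.foldExtension_mem_lipschitzSobolev (hconv : Convex ℝ Ω) (hΩo : IsOpen Ω)
    (ha0 : 0 < a) (ha : Metric.ball 0 a ⊆ Ω) (hΩ : Ω ⊆ Metric.closedBall 0 1) {L K : ℝ}
    (hL : 1 ≤ L) (hLa : (4 * (a ^ 2)⁻¹ - 2) * L ≤ L ^ 2 + 1) (hLK : 3 * L ≤ K)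
    (hK : 6 * (a ^ 2)⁻¹ + 1 ≤ K) {φ : Plane → ℝ} (hφ : φ ∈ smoothCompactSupport) :
    foldExtension Ω φ ∈ lipschitzSobolev Set.univ := by
  have hlip := hconv.exists_lipschitzWith_foldExtension ha0 ha hΩ hφ
  obtain ⟨C, hC⟩ := hlip
  have hfin : ∫⁻ x, (‖foldExtension Ω φ x‖ₑ ^ 2 + ‖gradient (foldExtension Ω φ) x‖ₑ ^ 2) < ⊤ := by
    refine (hconv.lintegral_energy_foldExtension_le hΩo ha0 ha hΩ hL hLa hLK hK
      (hφ.1.differentiable (by simp))).trans_lt (ENNReal.mul_lt_top ENNReal.ofReal_lt_top ?_)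
    have := ofReal_norm_sq_lipschitzToSobolev (Ω := Ω)
      ⟨φ, smoothCompactSupport_le_lipschitzSobolev Ω hφ⟩
    exact this ▸ ENNReal.ofReal_lt_top
  have hmem : ∀ {F : Type} [NormedAddCommGroup F] (f : Plane → F), AEStronglyMeasurable f volume →
      ∫⁻ x, ‖f x‖ₑ ^ 2 < ⊤ → MemLp f 2 (volume.restrict Set.univ) := by
    intro F _ f hf h
    rw [Measure.restrict_univ]
    refine ⟨hf, ?_⟩
    rw [lintegral_enorm_sq_eq_eLpNorm_sq] at h
    exact (ENNReal.pow_lt_top_iff.1 h).resolve_right two_ne_zero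
  refine ⟨⟨C, hC⟩, hmem _ hC.continuous.aestronglyMeasurable ?_,
    hmem _ (aestronglyMeasurable_gradient _ _) ?_⟩
  · exact (lintegral_mono fun x => le_self_add).trans_lt hfin
  · exact (lintegral_mono fun x => le_add_self).trans_lt hfin

end

/-! ### The extension operator -/

theorem eLpNorm_toLp_le {Ω Ω' : Set Plane} (hΩ : Ω ⊆ Ω') (w : SobolevH1 Ω') :
    eLpNorm w.toLp 2 (volume.restrict Ω) ≤ ENNReal.ofReal ‖w‖ := by
  have h1 : eLpNorm w.toLp 2 (volume.restrict Ω) ≤ ‖w.toLp‖ₑ := by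
    rw [Lp.enorm_def]
    exact eLpNorm_mono_measure _ (Measure.restrict_mono_set _ hΩ)
  refine h1.trans ?_
  rw [← ofReal_norm]
  exact ENNReal.ofReal_le_ofReal (WithLp.norm_fst_le _ w.1)

/-- Each test function and direction equates two continuous functionals, given by `L²` inner
products. Closedness gives the completeness needed to extend the operator from a dense subspace. -/
theorem isClosed_sobolevSubmodule (Ω : Set Plane) :
    IsClosed (sobolevSubmodule Ω : Set (WithLp 2
      (Lp ℝ 2 (volume.restrict Ω) × Lp Plane 2 (volume.restrict Ω)))) := by
  have e : (sobolevSubmodule Ω : Set (WithLp 2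
      (Lp ℝ 2 (volume.restrict Ω) × Lp Plane 2 (volume.restrict Ω))))
      = ⋂ (φ : Plane → ℝ) (_ : IsTestFunction Ω φ) (v : Plane),
        {w | ∫ x in Ω, w.fst x * fderiv ℝ φ x v = - ∫ x in Ω, ⟪w.snd x, v⟫ * φ x} := by
    ext w
    simp only [Set.mem_iInter, Set.mem_ofPred_eq]
    rfl
  rw [e]
  refine isClosed_iInter fun φ => isClosed_iInter fun hφ => isClosed_iInter fun v => ?_
  have hφv : MemLp (fun x => φ x • v) 2 (volume.restrict Ω) :=
    ((hφ.1.continuous.smul continuous_const).memLp_of_hasCompactSupport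
      (hφ.2.1.smul_right (f' := fun _ => v))).restrict Ω
  have e1 : ∀ u : Lp ℝ 2 (volume.restrict Ω), ∫ x in Ω, u x * fderiv ℝ φ x v
      = ⟪(hφ.memLp_fderiv v).toLp, u⟫ := by
    intro u
    rw [L2.inner_def]
    apply integral_congr_ae
    filter_upwards [(hφ.memLp_fderiv v).coeFn_toLp] with x hx
    rw [hx]
    simp
  have e2 : ∀ g : Lp Plane 2 (volume.restrict Ω), ∫ x in Ω, ⟪g x, v⟫ * φ x
      = ⟪hφv.toLp, g⟫ := by
    intro g
    rw [L2.inner_def]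
    apply integral_congr_ae
    filter_upwards [hφv.coeFn_toLp] with x hx
    rw [hx, real_inner_smul_left, real_inner_comm, mul_comm]
  simp only [e1, e2]
  have c1 : Continuous fun w : WithLp 2 (Lp ℝ 2 (volume.restrict Ω)
      × Lp Plane 2 (volume.restrict Ω)) => w.fst := WithLp.continuous_fst _ _ _
  have c2 : Continuous fun w : WithLp 2 (Lp ℝ 2 (volume.restrict Ω)
      × Lp Plane 2 (volume.restrict Ω)) => w.snd := WithLp.continuous_snd _ _ _
  exact isClosed_eq (continuous_const.inner c1) (continuous_const.inner c2).neg

instance (Ω : Set Plane) : CompleteSpace (SobolevH1 Ω) :=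
  (isClosed_sobolevSubmodule Ω).completeSpace_coe

theorem smoothToSobolev_toLp_ae (Ω : Set Plane) (φ : smoothCompactSupport) :
    (smoothToSobolev Ω φ).toLp =ᵐ[volume.restrict Ω] φ.1 :=
  ((smoothCompactSupport_le_lipschitzSobolev Ω) φ.2).2.1.coeFn_toLp

theorem SobolevH1.toLp_sub_ae {Ω : Set Plane} (v w : SobolevH1 Ω) :
    (v - w).toLp =ᵐ[volume.restrict Ω] ⇑v.toLp - ⇑w.toLp :=
  Lp.coeFn_sub v.toLp w.toLp

theorem SobolevH1.toLp_sub_toLp_ae_eq {Ω : Set Plane} (v : SobolevH1 (Set.univ : Set Plane))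
    (u : SobolevH1 Ω) {v' : SobolevH1 (Set.univ : Set Plane)} {u' : SobolevH1 Ω}
    (h : v'.toLp =ᵐ[volume.restrict Ω] u'.toLp) :
    ⇑v.toLp - ⇑u.toLp =ᵐ[volume.restrict Ω] ⇑(v - v').toLp - ⇑(u - u').toLp := by
  have e1 := SobolevH1.toLp_sub_ae u u'
  have e2 := ae_mono (Measure.restrict_mono_set volume (Set.subset_univ Ω))
    (SobolevH1.toLp_sub_ae v v')
  filter_upwards [e1, e2, h] with x h1 h2 h3
  simp only [Pi.sub_apply] at h1 h2 ⊢
  rw [h1, h2, h3]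
  ring

theorem exists_norm_sub_smoothToSobolev_lt {Ω : Set Plane}
    (hdense : DenseRange (smoothToSobolev Ω)) (u : SobolevH1 Ω) {ε : ℝ} (hε : 0 < ε) :
    ∃ φ, ‖u - smoothToSobolev Ω φ‖ < ε := by
  obtain ⟨φ, hφ⟩ := hdense.exists_dist_lt u hε
  exact ⟨φ, by rwa [dist_eq_norm] at hφ⟩

theorem SobolevH1.aestronglyMeasurable_toLp_restrict {Ω : Set Plane}
    (v : SobolevH1 (Set.univ : Set Plane)) : AEStronglyMeasurable v.toLp (volume.restrict Ω) :=
  (Lp.stronglyMeasurable v.toLp).aestronglyMeasurable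

theorem eLpNorm_toLp_sub_toLp_le {Ω : Set Plane} (v : SobolevH1 (Set.univ : Set Plane))
    (d : SobolevH1 Ω) : eLpNorm (⇑v.toLp - ⇑d.toLp) 2 (volume.restrict Ω)
      ≤ ENNReal.ofReal (‖v‖ + ‖d‖) := by
  rw [ENNReal.ofReal_add (norm_nonneg _) (norm_nonneg _)]
  exact (eLpNorm_sub_le v.aestronglyMeasurable_toLp_restrict (Lp.aestronglyMeasurable _)
    (by norm_num)).trans
    (add_le_add (eLpNorm_toLp_le (Set.subset_univ _) _) (eLpNorm_toLp_le subset_rfl _))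

theorem eLpNorm_toLp_map_sub_toLp_le {Ω : Set Plane}
    {E : SobolevH1 Ω →L[ℝ] SobolevH1 (Set.univ : Set Plane)} {φ : smoothCompactSupport}
    (hE : ∀ᵐ x ∂(volume.restrict Ω), (E (smoothToSobolev Ω φ)).toLp x = φ.1 x) (u : SobolevH1 Ω) :
    eLpNorm (⇑(E u).toLp - ⇑u.toLp) 2 (volume.restrict Ω)
      ≤ ENNReal.ofReal (‖E (u - smoothToSobolev Ω φ)‖ + ‖u - smoothToSobolev Ω φ‖) := by
  refine le_trans (le_of_eq (eLpNorm_congr_ae ?_)) (eLpNorm_toLp_sub_toLp_le _ _)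
  rw [E.map_sub]
  refine SobolevH1.toLp_sub_toLp_ae_eq (E u) u ?_
  filter_upwards [hE, smoothToSobolev_toLp_ae Ω φ] with x h1 h2
  rw [h1, h2]

/-- Restriction to `Ω` is continuous from `H¹` to `L²(Ω)`, so the identity passes from the dense
subspace to the limit: approximating `u` within `η` leaves an error at most `(C + 1) η`. -/
theorem isExtensionOperator_of_denseRange {Ω : Set Plane}
    (hdense : DenseRange (smoothToSobolev Ω))
    {E : SobolevH1 Ω →L[ℝ] SobolevH1 (Set.univ : Set Plane)} {C : ℝ} (hC0 : 0 ≤ C)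
    (hEn : ∀ u, ‖E u‖ ≤ C * ‖u‖)
    (hE : ∀ φ : smoothCompactSupport,
      ∀ᵐ x ∂(volume.restrict Ω), (E (smoothToSobolev Ω φ)).toLp x = φ.1 x) :
    IsExtensionOperator E := by
  intro u
  have hsmall : ∀ ε : ℝ, 0 < ε →
      eLpNorm (⇑(E u).toLp - ⇑u.toLp) 2 (volume.restrict Ω) ≤ ENNReal.ofReal ε := by
    intro ε hε
    obtain ⟨φ, hφ⟩ := exists_norm_sub_smoothToSobolev_lt hdense u
      (div_pos hε (by linarith : 0 < C + 1))
    refine (eLpNorm_toLp_map_sub_toLp_le (hE φ) u).trans (ENNReal.ofReal_le_ofReal ?_)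
    rw [lt_div_iff₀ (by linarith)] at hφ
    refine le_trans (add_le_add_left (hEn _) _) (le_trans (le_of_eq ?_) hφ.le)
    rw [mul_add, mul_one, mul_comm]
  have h : eLpNorm (⇑(E u).toLp - ⇑u.toLp) 2 (volume.restrict Ω) = 0 := by
    refine le_antisymm (ENNReal.le_of_forall_pos_le_add fun ε hε _ => ?_) zero_le
    rw [zero_add]
    exact (hsmall ε hε).trans_eq ENNReal.ofReal_coe_nnreal
  rw [eLpNorm_eq_zero_iff
    ((E u).aestronglyMeasurable_toLp_restrict.sub (Lp.aestronglyMeasurable _)) (by norm_num)] at h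
  filter_upwards [h] with x hx
  exact sub_eq_zero.1 hx

/-- An extension operator on smooth functions extends to the Sobolev space by density. -/
theorem exists_extensionOperator_of_denseRange {Ω : Set Plane}
    (hdense : DenseRange (smoothToSobolev Ω))
    (j : smoothCompactSupport →ₗ[ℝ] SobolevH1 (Set.univ : Set Plane)) {C : ℝ} (hC0 : 0 ≤ C)
    (hnorm : ∀ φ, ‖j φ‖ ≤ C * ‖smoothToSobolev Ω φ‖)
    (hj : ∀ φ : smoothCompactSupport, ∀ᵐ x ∂(volume.restrict Ω), (j φ).toLp x = φ.1 x) :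
    ∃ E : SobolevH1 Ω →L[ℝ] SobolevH1 (Set.univ : Set Plane),
      IsExtensionOperator E ∧ ‖E‖ ≤ C := by
  refine ⟨j.extendOfNorm (smoothToSobolev Ω), ?_,
    LinearMap.opNorm_extendOfNorm_le hdense hC0 hnorm⟩
  refine isExtensionOperator_of_denseRange hdense hC0
    (LinearMap.norm_extendOfNorm_apply_le hdense C hnorm) fun φ => ?_
  rw [LinearMap.extendOfNorm_eq hdense ⟨_, hnorm⟩]
  exact hj φ

/-- Bounded extension operators for open convex sets between two concentric discs. -/
theorem Convex.exists_extensionOperator {Ω : Set Plane} {a : ℝ} (hconv : Convex ℝ Ω)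
    (hΩo : IsOpen Ω) (ha0 : 0 < a) (ha : Metric.ball 0 a ⊆ Ω) (hΩ : Ω ⊆ Metric.closedBall 0 1)
    {L K : ℝ} (hL : 1 ≤ L) (hLa : (4 * (a ^ 2)⁻¹ - 2) * L ≤ L ^ 2 + 1) (hLK : 3 * L ≤ K)
    (hK : 6 * (a ^ 2)⁻¹ + 1 ≤ K) :
    ∃ E : SobolevH1 Ω →L[ℝ] SobolevH1 (Set.univ : Set Plane),
      IsExtensionOperator E ∧ ‖E‖ ≤ Real.sqrt (1 + K) := by
  have hK0 : 0 ≤ K := by linarith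
  let J : smoothCompactSupport →ₗ[ℝ] lipschitzSobolev Set.univ :=
    { toFun := fun φ => ⟨foldExtension Ω φ,
        hconv.foldExtension_mem_lipschitzSobolev hΩo ha0 ha hΩ hL hLa hLK hK φ.2⟩
      map_add' := fun φ ψ => Subtype.ext (funext fun x => mul_add _ _ _)
      map_smul' := fun c φ => Subtype.ext (funext fun x => mul_left_comm _ _ _) }
  refine exists_extensionOperator_of_denseRange
    (denseRange_smoothToSobolev hΩo hconv ha0 ha hΩ) (lipschitzToSobolev Set.univ ∘ₗ J)
    (Real.sqrt_nonneg _) (fun φ => ?_) (fun φ => ?_)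
  · refine le_of_sq_le_sq ?_ (by positivity)
    rw [mul_pow, Real.sq_sqrt (by linarith), ← ENNReal.ofReal_le_ofReal_iff (by positivity),
      ENNReal.ofReal_mul (by linarith)]
    have h := hconv.lintegral_energy_foldExtension_le hΩo ha0 ha hΩ hL hLa hLK hK
      (φ.2.1.differentiable (by simp))
    have h1 := ofReal_norm_sq_lipschitzToSobolev (J φ)
    have h2 := ofReal_norm_sq_lipschitzToSobolev (Ω := Ω)
      (Submodule.inclusion (smoothCompactSupport_le_lipschitzSobolev Ω) φ)
    rw [← setLIntegral_univ] at h
    exact (h1.trans_le h).trans_eq (congrArg _ h2.symm)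
  · have e : ⇑(lipschitzToSobolev Set.univ (J φ)).toLp =ᵐ[volume.restrict Set.univ]
        foldExtension Ω φ := (J φ).2.2.1.coeFn_toLp
    have e' := ae_mono (Measure.restrict_mono_set volume (Set.subset_univ Ω)) e
    filter_upwards [e', ae_restrict_mem hΩo.measurableSet] with x h1 h2
    exact h1.trans (hconv.foldExtension_of_mem hΩo ha0 ha _ h2)

/-! ### Numerical constants and the regular polygons -/

theorem four_fifths_le_cos_pi_div_five : 4 / 5 ≤ Real.cos (Real.pi / (5 : ℕ)) := by
  have h5 : (11 / 5 : ℝ) ≤ √5 := Real.le_sqrt_of_sq_le (by norm_num)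
  rw [Nat.cast_ofNat, Real.cos_pi_div_five]
  linarith

theorem sqrt_three_div_two_le_cos_pi_div {n : ℕ} (hn : 6 ≤ n) :
    √3 / 2 ≤ Real.cos (Real.pi / n) := by
  have hpi := Real.pi_pos
  have hn' : (6 : ℝ) ≤ n := by exact_mod_cast hn
  rw [← Real.cos_pi_div_six]
  apply Real.cos_le_cos_of_nonneg_of_le_pi (by positivity)
  · linarith
  · gcongr

/-- For `n ≥ 6`, `cos (2π/n) ≥ cos (π/3) = 1/2`, with equality at the hexagon. -/
theorem sqrt_ten_le_extensionConstant {n : ℕ} (hn : 6 ≤ n) :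
    √(1 + 9) ≤ extensionConstant n := by
  have hpi := Real.pi_pos
  have hn' : (6 : ℝ) ≤ n := by exact_mod_cast hn
  rw [extensionConstant, if_neg (by omega)]
  apply Real.sqrt_le_sqrt
  have hc : 1 / 2 ≤ Real.cos (2 * Real.pi / n) := by
    rw [← Real.cos_pi_div_three]
    apply Real.cos_le_cos_of_nonneg_of_le_pi (by positivity)
    · linarith
    · rw [div_le_div_iff₀ (by positivity) (by positivity)]
      nlinarith
  nlinarith

theorem mainTheorem6 (n : ℕ) (hn : 5 ≤ n) :
    ∃ E : SobolevH1 (regularPolygon n) →L[ℝ] SobolevH1 (Set.univ : Set Plane),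
      IsExtensionOperator E ∧ ‖E‖ ≤ extensionConstant n := by
  have hopen := isOpen_regularPolygon n
  have hconv := convex_regularPolygon n
  have hsub := regularPolygon_subset_closedBall n
  have hball := ball_subset_regularPolygon (n := n) (by omega)
  rcases eq_or_lt_of_le hn with rfl | hn6
  · have h4 : √(1 + 15) ≤ extensionConstant 5 := by
      rw [extensionConstant, if_pos rfl]
      exact Real.sqrt_le_iff.2 (by norm_num)
    -- Here `4/a² - 2 = 17/4 = 4 + 1/4`, whence `L = 4`. The constraints on `K` only ask for `12`;
    -- `15` is the value with `1 + K = 4²`.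
    obtain ⟨E, hE, hEn⟩ := hconv.exists_extensionOperator hopen (a := 4 / 5) (by norm_num)
      ((Metric.ball_subset_ball four_fifths_le_cos_pi_div_five).trans hball) hsub
      (L := 4) (K := 15) (by norm_num) (by norm_num) (by norm_num) (by norm_num)
    exact ⟨E, hE, hEn.trans h4⟩
  · have hsq : (√3 / 2) ^ 2 = 3 / 4 := by rw [div_pow, Real.sq_sqrt (by norm_num)]; norm_num
    -- Here `4/a² - 2 = 10/3 = 3 + 1/3`, whence `L = 3`, and both `3L` and `6/a² + 1` equal `9`.
    obtain ⟨E, hE, hEn⟩ := hconv.exists_extensionOperator hopen (a := √3 / 2) (by positivity)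
      ((Metric.ball_subset_ball (sqrt_three_div_two_le_cos_pi_div hn6)).trans hball) hsub
      (L := 3) (K := 9) (by norm_num) (by rw [hsq]; norm_num) (by norm_num)
      (by rw [hsq]; norm_num)
    exact ⟨E, hE, hEn.trans (sqrt_ten_le_extensionConstant hn6)⟩
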